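/- Let $\mathcal G$ be a Grothendieck category and let $\mathbf t=(\mathcal T,\mathcal F)$ be a torsion pair in $\mathcal G$, that is, a pair of full subcategories (closed under isomorphisms) such that $\mathrm{Hom}_{\mathcal G}(T,F)=0$ for all $T\in\mathcal T$, $F\in\mathcal F$, and such that every object $X$ of $\mathcal G$ fits into a short exact sequence $0\to t(X)\to X\to X/t(X)\to 0$ with $t(X)\in\mathcal T$ and $X/t(X)\in\mathcal F$. Let $\mathcal H_{\mathbf t}$ be the heart of the associated Happel–Reiten–Smalø t-structure in the derived category $\mathcal D(\mathcal G)$, whose aisle is $\{X\in\mathcal D^{\le 0}(\mathcal G)\mid H^0(X)\in\mathcal T\}$ and whose co-aisle is $\{Y\in\mathcal D^{\ge -1}(\mathcal G)\mid H^{-1}(Y)\in\mathcal F\}$; thus $\mathcal H_{\mathbf t}$ is the full subcategory of $\mathcal D(\mathcal G)$ consisting of the objects $M$ with $H^0(M)\in\mathcal T$, $H^{-1}(M)\in\mathcal F$ and $H^k(M)=0$ for $k\neq -1,0$. Direct systems are indexed by (small, nonempty, upward) directed partially ordered sets; $\varinjlim$ denotes the direct limit in $\mathcal G$ and $\varinjlim_{\mathcal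 H_{\mathbf t}}$ the one in $\mathcal H_{\mathbf t}$. The following assertions are equivalent: 1. $\mathcal H_{\mathbf t}$ is an AB5 abelian category, i.e. it is abelian, has all (set-indexed) coproducts, and its direct limits are exact. 2. $\mathcal F$ is closed under direct limits in $\mathcal G$ and, for each direct system $((M_i)_{i\in I},(u_{ij})_{i\le j})$ in $\mathcal H_{\mathbf t}$ and each distinguished triangle $$\coprod_{i\le j}M_{ij}\xrightarrow{\ f\ }\coprod_{i\in I}M_i\longrightarrow Z\longrightarrow \Big(\coprod_{i\le j}M_{ij}\Big)[1]$$ in $\mathcal D(\mathcal G)$, where the coproducts are taken in $\mathcal D(\mathcal G)$, $M_{ij}=M_i$ for $i\le j$, and $f$ is the colimit-defining morphism, given on the component indexed by $i\le j$ by $\lambda_i-\lambda_j\circ u_{ij}$ with $\lambda_i:M_i\to\coprod_{i\in I}M_i$ the canonical morphisms, the composition of canonical morphisms $$\varinjlim H^{-1}(M_i)\longrightarrow H^{-1}(Z)\longrightarrow H^{-1}(Z)/t(H^{-1}(Z))$$ is a monomorphism. 3. $\mathcal F$ is closed under direct limits in $\mathcal G$ and, for each direct system $(M_i)_{i\in I}$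 in $\mathcal H_{\mathbf t}$, the canonical morphism $\varinjlim H^{-1}(M_i)\to H^{-1}(\varinjlim_{\mathcal H_{\mathbf t}}M_i)$ is a monomorphism. 4. For every $m\in\mathbb Z$, the classical cohomology functor $H^m:\mathcal H_{\mathbf t}\to\mathcal G$ preserves direct limits. -/

import Mathlib

open CategoryTheory CategoryTheory.Limits CategoryTheory.Pretriangulated
open CategoryTheory.Triangulated

universe w v u

/-- A torsion pair `(𝒯, ℱ)` in an abelian category: two full subcategories
(closed under isomorphisms) with `Hom(T, F) = 0` for `T ∈ 𝒯`, `F ∈ ℱ`, such that every object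
`X` sits in a short exact sequence `0 ⟶ T ⟶ X ⟶ F ⟶ 0` with `T ∈ 𝒯` and `F ∈ ℱ`. -/
structure TorsionPair (C : Type u) [Category.{v} C] [Abelian C] where
  /-- the torsion class -/
  torsion : ObjectProperty C
  /-- the torsion-free class -/
  torsionFree : ObjectProperty C
  torsion_iso : torsion.IsClosedUnderIsomorphisms
  torsionFree_iso : torsionFree.IsClosedUnderIsomorphisms
  hom_eq_zero : ∀ ⦃T F : C⦄ (f : T ⟶ F), torsion T → torsionFree F → f = 0
  exists_shortExact : ∀ X : C, ∃ (T F : C) (i : T ⟶ X) (p : X ⟶ F) (h : i ≫ p = 0),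
    torsion T ∧ torsionFree F ∧ (ShortComplex.mk i p h).ShortExact

namespace TorsionPair

attribute [instance] torsion_iso torsionFree_iso

section

variable {C : Type u} [Category.{v} C] [Abelian C] (t : TorsionPair C)

/-- The torsion part `t(X)` of `X`. -/
noncomputable def radical (X : C) : C := (t.exists_shortExact X).choose

/-- The torsion-free quotient `X / t(X)` of `X`. -/
noncomputable def quotient (X : C) : C := (t.exists_shortExact X).choose_spec.choose

/-- The inclusion `t(X) ⟶ X`. -/
noncomputable def ι (X : C) : t.radical X ⟶ X :=
  (t.exists_shortExact X).choose_spec.choose_spec.choose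

/-- The projection `X ⟶ X / t(X)`. -/
noncomputable def π (X : C) : X ⟶ t.quotient X :=
  (t.exists_shortExact X).choose_spec.choose_spec.choose_spec.choose

lemma ι_π (X : C) : t.ι X ≫ t.π X = 0 :=
  (t.exists_shortExact X).choose_spec.choose_spec.choose_spec.choose_spec.choose

lemma torsion_radical (X : C) : t.torsion (t.radical X) :=
  (t.exists_shortExact X).choose_spec.choose_spec.choose_spec.choose_spec.choose_spec.1

lemma torsionFree_quotient (X : C) : t.torsionFree (t.quotient X) :=
  (t.exists_shortExact X).choose_spec.choose_spec.choose_spec.choose_spec.choose_spec.2.1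

lemma shortExact (X : C) : (ShortComplex.mk (t.ι X) (t.π X) (t.ι_π X)).ShortExact :=
  (t.exists_shortExact X).choose_spec.choose_spec.choose_spec.choose_spec.choose_spec.2.2

lemma torsion_of_isZero {X : C} (hX : IsZero X) : t.torsion X := by
  have : Mono (t.ι X) := (t.shortExact X).mono_f
  exact t.torsion.prop_of_iso ((IsZero.of_mono (t.ι X) hX).iso hX) (t.torsion_radical X)

lemma torsionFree_of_isZero {X : C} (hX : IsZero X) : t.torsionFree X := by
  have : Epi (t.π X) := (t.shortExact X).epi_g
  exact t.torsionFree.prop_of_iso ((IsZero.of_epi (t.π X) hX).iso hX) (t.torsionFree_quotient X)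

end

section

variable {G : Type u} [Category.{v} G] [Abelian G] [HasDerivedCategory.{w} G] (t : TorsionPair G)

open DerivedCategory

/-- The objects `X` of `D(G)` with `Hⁱ(X) = 0` for `i > n` and `Hⁿ(X) ∈ 𝒯`. For `n = 0` this
is the aisle of the Happel-Reiten-Smalø t-structure. -/
def hrsLE (n : ℤ) : ObjectProperty (DerivedCategory G) :=
  fun X ↦ X.IsLE n ∧ t.torsion ((homologyFunctor G n).obj X)

/-- The objects `X` of `D(G)` with `Hⁱ(X) = 0` for `i < n - 1` and `Hⁿ⁻¹(X) ∈ ℱ`. For `n = 0` this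
is the co-aisle of the Happel-Reiten-Smalø t-structure. -/
def hrsGE (n : ℤ) : ObjectProperty (DerivedCategory G) :=
  fun X ↦ X.IsGE (n - 1) ∧ t.torsionFree ((homologyFunctor G (n - 1)).obj X)

instance (n : ℤ) : (t.hrsLE n).IsClosedUnderIsomorphisms where
  of_iso e h := ⟨by have := h.1; exact TStructure.t.isLE_of_iso e n,
    t.torsion.prop_of_iso ((homologyFunctor G n).mapIso e) h.2⟩

instance (n : ℤ) : (t.hrsGE n).IsClosedUnderIsomorphisms where
  of_iso e h := ⟨by have := h.1; exact TStructure.t.isGE_of_iso e _,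
    t.torsionFree.prop_of_iso ((homologyFunctor G (n - 1)).mapIso e) h.2⟩

/-- A morphism from an object in degrees `≤ 0` to an object in degrees `≥ 0` is zero
if it induces the zero morphism on `H⁰`. -/
lemma eq_zero_of_homology_map_eq_zero {X Y : DerivedCategory G} [hX : X.IsLE 0] [hY : Y.IsGE 0]
    (f : X ⟶ Y) (hf : (homologyFunctor G 0).map f = 0) : f = 0 := by
  obtain ⟨X₁, X₂, h₁, h₂, a, b, c, hT⟩ := TStructure.t.exists_triangle X (-1) 0 (by lia)
  obtain ⟨Y₁, Y₂, h₃, h₄, a', b', c', hT'⟩ := TStructure.t.exists_triangle Y 0 1 (by lia)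
  have i₁ : X₁.IsLE (-1) := ⟨h₁⟩
  have i₂ : X₂.IsGE 0 := ⟨h₂⟩
  have i₃ : Y₁.IsLE 0 := ⟨h₃⟩
  have i₄ : Y₂.IsGE 1 := ⟨h₄⟩
  have e₂ : X₂.IsLE 0 := by
    rw [isLE_iff]
    intro i hi
    exact (HomologySequence.exact₃ _ hT i (i + 1)).isZero_of_both_zeros
      ((X.isZero_of_isLE 0 i hi).eq_of_src _ _)
      ((X₁.isZero_of_isLE (-1) (i + 1) (by lia)).eq_of_tgt _ _)
  have e₁ : Y₁.IsGE 0 := by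
    rw [isGE_iff]
    intro i hi
    exact (HomologySequence.exact₁ _ hT' (i - 1) i).isZero_of_both_zeros
      ((Y₂.isZero_of_isGE 1 (i - 1) (by lia)).eq_of_src _ _)
      ((Y.isZero_of_isGE 0 i hi).eq_of_tgt _ _)
  obtain ⟨g, hg⟩ := Triangle.yoneda_exact₂ _ hT f
    (TStructure.t.zero (X := X₁) _ (-1) 0 (by lia))
  obtain ⟨k, hk⟩ := Triangle.coyoneda_exact₂ _ hT' g
    (TStructure.t.zero (X := X₂) (Y := Y₂) _ 0 1 (by lia))
  change X₂ ⟶ Y at g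
  change f = b ≫ g at hg
  change X₂ ⟶ Y₁ at k
  change g = k ≫ a' at hk
  obtain ⟨A, ⟨eA⟩⟩ := exists_iso_singleFunctor_obj_of_isGE_of_isLE X₂ 0
  obtain ⟨B, ⟨eB⟩⟩ := exists_iso_singleFunctor_obj_of_isGE_of_isLE Y₁ 0
  have hb : Epi ((homologyFunctor G 0).map b) :=
    (HomologySequence.epi_homologyMap_mor₂_iff _ hT 0 1).2
      ((X₁.isZero_of_isLE (-1) 1 (by lia)).eq_of_tgt _ _)
  have ha : Mono ((homologyFunctor G 0).map a') :=
    (HomologySequence.mono_homologyMap_mor₁_iff _ hT' (-1) 0).2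
      ((Y₂.isZero_of_isGE 1 (-1) (by lia)).eq_of_src _ _)
  have hk0 : (homologyFunctor G 0).map k = 0 := by
    rw [← cancel_epi ((homologyFunctor G 0).map b), ← cancel_mono ((homologyFunctor G 0).map a')]
    simp only [comp_zero, zero_comp, ← Functor.map_comp, Category.assoc]
    rw [← hk, ← hg, hf]
  obtain ⟨m, hm⟩ := (singleFunctor G 0).map_surjective (eA.inv ≫ k ≫ eB.hom)
  have hm0 : m = 0 := by
    have := NatIso.naturality_1 (singleFunctorCompHomologyFunctorIso G 0) m
    dsimp at this
    rw [← this, hm]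
    simp [hk0]
  have : k = 0 := by
    rw [← cancel_epi eA.inv, ← cancel_mono eB.hom, Category.assoc, ← hm, hm0]
    simp
  rw [hg, hk, this]
  simp

/-- The Happel-Reiten-Smalø t-structure on `D(G)` associated with a torsion pair `(𝒯, ℱ)` in `G`.
Its aisle is `{X ∈ D^{≤ 0}(G) | H⁰(X) ∈ 𝒯}`, and its co-aisle is
`{Y ∈ D^{≥ -1}(G) | H⁻¹(Y) ∈ ℱ}`. -/
noncomputable def hrsTStructure : TStructure (DerivedCategory G) where
  le n := t.hrsLE n
  ge n := t.hrsGE n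
  le_shift n a n' h X hX := by
    have := hX.1
    exact ⟨TStructure.t.isLE_shift X n a n' h,
      t.torsion.prop_of_iso
        (((homologyFunctor G 0).shiftIso a n' n h).app X).symm hX.2⟩
  ge_shift n a n' h X hX := by
    have := hX.1
    exact ⟨TStructure.t.isGE_shift X (n - 1) a (n' - 1) (by lia),
      t.torsionFree.prop_of_iso
        (((homologyFunctor G 0).shiftIso a (n' - 1) (n - 1) (by lia)).app X).symm hX.2⟩
  zero' X Y f hX hY := by
    have := hX.1
    have h1 : Y.IsGE 0 := hY.1
    exact eq_zero_of_homology_map_eq_zero f (t.hom_eq_zero _ hX.2 hY.2)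
  le_zero_le X hX := by
    have := hX.1
    exact ⟨TStructure.t.isLE_of_le X 0 1, t.torsion_of_isZero (X.isZero_of_isLE 0 1 (by lia))⟩
  ge_one_le X hX := by
    have h1 : X.IsGE 0 := hX.1
    exact ⟨TStructure.t.isGE_of_ge X (0 - 1) 0,
      t.torsionFree_of_isZero (X.isZero_of_isGE 0 (0 - 1) (by lia))⟩
  exists_triangle_zero_one A := by
    obtain ⟨X, Y, h₁, h₂, a, b, c, hT⟩ := TStructure.t.exists_triangle A 0 1 (by lia)
    obtain ⟨X₁, X₂, h₃, h₄, a', b', c', hT'⟩ := TStructure.t.exists_triangle X (-1) 0 (by lia)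
    have i₁ : X.IsLE 0 := ⟨h₁⟩
    have i₂ : Y.IsGE 1 := ⟨h₂⟩
    have i₃ : X₁.IsLE (-1) := ⟨h₃⟩
    have i₄ : X₂.IsGE 0 := ⟨h₄⟩
    have e₂ : X₂.IsLE 0 := by
      rw [isLE_iff]
      intro i hi
      exact (HomologySequence.exact₃ _ hT' i (i + 1)).isZero_of_both_zeros
        ((X.isZero_of_isLE 0 i hi).eq_of_src _ _)
        ((X₁.isZero_of_isLE (-1) (i + 1) (by lia)).eq_of_tgt _ _)
    obtain ⟨B, ⟨eB⟩⟩ := exists_iso_singleFunctor_obj_of_isGE_of_isLE X₂ 0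
    have hb : Epi ((homologyFunctor G 0).map b') :=
      (HomologySequence.epi_homologyMap_mor₂_iff _ hT' 0 1).2
        ((X₁.isZero_of_isLE (-1) 1 (by lia)).eq_of_tgt _ _)
    have ha' : (homologyFunctor G 0).map a' = 0 :=
      (X₁.isZero_of_isLE (-1) 0 (by lia)).eq_of_src _ _
    have hb' : Mono ((homologyFunctor G 0).map b') :=
      (HomologySequence.mono_homologyMap_mor₂_iff _ hT' 0).2 ha'
    have hbi : IsIso ((homologyFunctor G 0).map b') := isIso_of_mono_of_epi _
    let σ := singleFunctorCompHomologyFunctorIso G 0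
    let p : X ⟶ (singleFunctor G 0).obj (t.quotient B) :=
      b' ≫ eB.hom ≫ (singleFunctor G 0).map (t.π B)
    let φ : (homologyFunctor G 0).obj X ≅ B :=
      asIso ((homologyFunctor G 0).map b') ≪≫ (homologyFunctor G 0).mapIso eB ≪≫ σ.app B
    have hp : (homologyFunctor G 0).map p ≫ σ.hom.app _ = φ.hom ≫ t.π B := by
      have := σ.hom.naturality (t.π B)
      dsimp at this
      simp [p, φ, this]
    obtain ⟨U, j, k, hU⟩ := distinguished_cocone_triangle₁ p
    obtain ⟨W, q, r, hW⟩ := distinguished_cocone_triangle (j ≫ a)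
    have O := someOctahedron rfl hU hT hW
    have hep : Epi (t.π B) := (t.shortExact B).epi_g
    have hpe : Epi ((homologyFunctor G 0).map p) := by
      have : (homologyFunctor G 0).map p =
          (φ.hom ≫ t.π B) ≫ (σ.app (t.quotient B)).inv := by
        rw [← hp]; simp
      rw [this]
      infer_instance
    have hU0 : U.IsLE 0 := by
      rw [isLE_iff]
      intro i hi
      refine (HomologySequence.exact₁ _ hU (i - 1) i).isZero_of_both_zeros ?_
        ((X.isZero_of_isLE 0 i hi).eq_of_tgt _ _)
      by_cases h : i = 1
      · subst h
        exact (HomologySequence.epi_homologyMap_mor₂_iff _ hU (1 - 1) 1).1 hpe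
      · exact (isZero_of_isLE ((singleFunctor G 0).obj (t.quotient B)) 0 (i - 1)
          (by lia)).eq_of_src _ _
    have hUT : t.torsion ((homologyFunctor G 0).obj U) := by
      have hm : Mono ((homologyFunctor G 0).map j) :=
        (HomologySequence.mono_homologyMap_mor₁_iff _ hU (-1) 0).2
          ((isZero_of_isGE ((singleFunctor G 0).obj (t.quotient B)) 0 (-1)
            (by lia)).eq_of_src _ _)
      have hex := HomologySequence.exact₂ _ hU 0
      have : Mono ((homologyFunctor G 0).map (Triangle.mk j p k).mor₁) := hm
      have : Mono (t.ι B) := (t.shortExact B).mono_f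
      let S := ShortComplex.mk (t.ι B) (t.π B) (t.ι_π B)
      let e : (homologyFunctor G 0).obj U ≅ t.radical B :=
        IsLimit.conePointsIsoOfNatIso
          (s := KernelFork.ofι _ (ShortComplex.mk ((homologyFunctor G 0).map j)
            ((homologyFunctor G 0).map p) _).zero)
          (t := KernelFork.ofι _ S.zero)
          (hex.fIsKernel) (t.shortExact B).fIsKernel
          (parallelPair.ext φ (σ.app _) (by simp [hp, S]) (by simp))
      exact t.torsion.prop_of_iso e.symm (t.torsion_radical B)
    have hW1 : W.IsGE 0 := by
      rw [isGE_iff]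
      intro i hi
      exact (HomologySequence.exact₂ _ O.mem i).isZero_of_both_zeros
        ((isZero_of_isGE ((singleFunctor G 0).obj (t.quotient B)) 0 i hi).eq_of_src _ _)
        ((Y.isZero_of_isGE 1 i (by lia)).eq_of_tgt _ _)
    have hWF : t.torsionFree ((homologyFunctor G 0).obj W) := by
      have hm : Mono ((homologyFunctor G 0).map O.m₁) :=
        (HomologySequence.mono_homologyMap_mor₁_iff _ O.mem (-1) 0).2
          ((Y.isZero_of_isGE 1 (-1) (by lia)).eq_of_src _ _)
      have he : Epi ((homologyFunctor G 0).map O.m₁) :=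
        (HomologySequence.epi_homologyMap_mor₁_iff _ O.mem 0).2
          ((Y.isZero_of_isGE 1 0 (by lia)).eq_of_tgt _ _)
      have : IsIso ((homologyFunctor G 0).map O.m₁) := isIso_of_mono_of_epi _
      exact t.torsionFree.prop_of_iso
        ((σ.app _).symm ≪≫ asIso ((homologyFunctor G 0).map O.m₁)) (t.torsionFree_quotient B)
    exact ⟨U, W, ⟨hU0, hUT⟩, ⟨hW1, hWF⟩, j ≫ a, q, r, hW⟩

/-- The heart of the Happel-Reiten-Smalø t-structure, as a full subcategory of `D(G)`. -/
abbrev Heart : Type (max u v) := t.hrsTStructure.heart.FullSubcategory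

/-- The heart consists of the objects `X` of `D(G)` such that `Hⁱ(X) = 0` for `i ≠ -1, 0`,
`H⁰(X) ∈ 𝒯` and `H⁻¹(X) ∈ ℱ`. -/
lemma heart_iff (X : DerivedCategory G) :
    t.hrsTStructure.heart X ↔
      (∀ i : ℤ, i ≠ -1 → i ≠ 0 → IsZero ((homologyFunctor G i).obj X)) ∧
      t.torsion ((homologyFunctor G 0).obj X) ∧
      t.torsionFree ((homologyFunctor G (-1)).obj X) := by
  change (X.IsLE 0 ∧ _) ∧ (X.IsGE (0 - 1) ∧ t.torsionFree ((homologyFunctor G (0 - 1)).obj X)) ↔ _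
  rw [zero_sub]
  rw [isLE_iff, isGE_iff]
  constructor
  · rintro ⟨⟨h₁, h₂⟩, h₃, h₄⟩
    refine ⟨fun i hi hi' ↦ ?_, h₂, h₄⟩
    rcases lt_or_gt_of_ne hi' with h | h
    · exact h₃ i (by lia)
    · exact h₁ i h
  · rintro ⟨h₁, h₂, h₃⟩
    exact ⟨⟨fun i hi ↦ h₁ i (by lia) (by lia), h₂⟩, fun i hi ↦ h₁ i (by lia) (by lia), h₃⟩

/-- The inclusion functor from the heart to `D(G)`. -/
noncomputable abbrev heartι : t.Heart ⥤ DerivedCategory G := t.hrsTStructure.heart.ι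

/-- The classical cohomology functor `H^m`, restricted to the heart. -/
noncomputable abbrev heartHomology (m : ℤ) : t.Heart ⥤ G := t.heartι ⋙ homologyFunctor G m

end

end TorsionPair

/-- The category `C` is abelian and satisfies the axiom AB5: it has coproducts indexed by sets and
its filtered colimits (equivalently, its direct limits) exist and are exact. Here "set" means a
type in the universe `w`. -/
def IsAB5Abelian (C : Type u) [Category.{v} C] : Prop :=
  Nonempty (Abelian C) ∧ HasCoproducts.{w} C ∧
    ∃ _ : HasFilteredColimitsOfSize.{w, w} C, AB5OfSize.{w, w} C

section

variable {C : Type u} [Category.{v} C] [Preadditive C] {I : Type*} [PartialOrder I] (M : I ⥤ C)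
  {c₂ : Cofan fun p : {p : I × I // p.1 ≤ p.2} ↦ M.obj p.1.1} (hc₂ : IsColimit c₂)
  (c₁ : Cofan M.obj)

/-- The colimit-defining morphism `f : ∐_{i ≤ j} M_{ij} ⟶ ∐_i M_i` of a direct system
`(M_i, u_{ij})`, where `M_{ij} = M_i`: on the component indexed by `i ≤ j` it is
`λ_i - λ_j ∘ u_{ij}`, where the `λ_i` are the canonical morphisms into `∐_i M_i`. -/
noncomputable def colimitDefiningMorphism : c₂.pt ⟶ c₁.pt :=
  Cofan.IsColimit.desc hc₂ fun p ↦ c₁.inj p.1.1 - M.map (homOfLE p.2) ≫ c₁.inj p.1.2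

variable {Z : C} (q : c₁.pt ⟶ Z)

lemma map_comp_inj_comp (h : colimitDefiningMorphism M hc₂ c₁ ≫ q = 0) {i j : I} (hij : i ≤ j) :
    M.map (homOfLE hij) ≫ c₁.inj j ≫ q = c₁.inj i ≫ q := by
  have := c₂.inj ⟨(i, j), hij⟩ ≫= h
  rw [colimitDefiningMorphism, Cofan.IsColimit.fac_assoc, comp_zero, Preadditive.sub_comp,
    sub_eq_zero, Category.assoc] at this
  exact this.symm

/-- A morphism `q : ∐_i M_i ⟶ Z` that vanishes on the colimit-defining morphism amounts to a
cocone `(M_i ⟶ Z)_i` on the direct system. -/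
noncomputable def colimitDefiningCocone (h : colimitDefiningMorphism M hc₂ c₁ ≫ q = 0) : Cocone M where
  pt := Z
  ι :=
    { app := fun i ↦ c₁.inj i ≫ q
      naturality := fun i j g ↦ by
        have := map_comp_inj_comp M hc₂ c₁ q h (leOfHom g)
        rw [Subsingleton.elim (homOfLE (leOfHom g)) g] at this
        simpa using this }

end

/-! The crux is that as soon as `ℱ` is closed under direct limits, the monomorphisms in assertions 2
and 3 are automatically isomorphisms. Let `f : ∐ M_ij ⟶ ∐ M_i` be the colimit-defining morphism and
`Z` its cone. Coproducts in `D(G)` are computed on complexes and commute with cohomology, so the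
cokernel of `Hⁿ(f)` is `lim Hⁿ(M_i)`. With `A = lim H⁻¹(M_i)`, the long exact sequence gives `0 ⟶ A
⟶ H⁻¹(Z) ⟶ H⁰(∐ M_ij) ⟶ H⁰(∐ M_i)`.

On the subcoproduct of the pairs `i ≤ j ≤ k`, with projection `e k`, the morphism `f` has a
generalized inverse `h k`, which sends `M_i` to the summand `(i, k)`. The morphism `e k - e k ≫ f ≫
h k` is killed by `f` already in `D(G)`, so on `H⁰` it lifts to `H⁻¹(Z)`. Thus the kernel of `H⁰(f)`
is a direct limit of retracts of a torsion object, over each of which `H⁻¹(Z)` has a section. If `A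
∈ ℱ`, then `Hom(T, A) = 0` for `T` torsion forces these sections to agree. They glue, `H⁻¹(Z)` is
the sum of `A` and a torsion object, and `A ≅ H⁻¹(Z)/t(H⁻¹(Z))`
(`TorsionPair.isIso_homology_cone_comp_π`).

The direct limit in the heart is the truncation of `Z` for the tilted t-structure; its `H⁻¹` is
`H⁻¹(Z)/t(H⁻¹(Z))` and its `H⁰` is `H⁰(Z)`. So closure of `ℱ` gives 2, 3 and 4. Conversely, 4 gives
closure, because a direct system in `ℱ`, placed in degree `-1`, is a system in the heart.

Closure implies AB5: for a short exact sequence of systems, the comparison of `lim M_i` with the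
kernel of `lim N_i ⟶ lim P_i` is checked to be an isomorphism on `H⁻¹` and `H⁰`
(`TorsionPair.mono_of_isColimit_heart`). AB5 implies closure: AB5 in the heart writes the kernel of
`M_i ⟶ lim M` as the limit of the kernels `K_j` of `M_i ⟶ M_j`. The limit of the `H⁻¹(K_j)` lies in
`H⁻¹(M_i)`, hence is torsion-free, so the crux applies to the system `K` and shows that `lim
H⁻¹(M_i) ⟶ H⁻¹(lim M)` is a monomorphism. -/

namespace CategoryTheory.ShortComplex

/-! ### Homology commutes with exact colimits. -/

variable {J C : Type*} [Category* J] [Category* C] [Abelian C] [HasColimitsOfShape J C]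

instance : (colim : (J ⥤ C) ⥤ C).PreservesZeroMorphisms where
  map_zero F G := by
    apply colimit.hom_ext
    intro j
    simp

/-- The natural transformation from the evaluation at `j` to the colimit functor. -/
@[simps]
noncomputable def evaluationToColim (j : J) : (evaluation J C).obj j ⟶ colim where
  app F := colimit.ι F j

/-- The colimit cocone of short complexes attached to a short complex of functors. -/
@[simps]
noncomputable def coconeMapColim (S : ShortComplex (J ⥤ C)) :
    Cocone ((FunctorEquivalence.functor J C).obj S) where
  pt := S.map colim
  ι :=
    { app j := S.mapNatTrans (evaluationToColim j)
      naturality i j f := by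
        refine Eq.trans ?_ (Category.comp_id _).symm
        ext
        · exact colimit.w S.X₁ f
        · exact colimit.w S.X₂ f
        · exact colimit.w S.X₃ f }

/-- `coconeMapColim S` is a colimit cocone. -/
noncomputable def isColimitCoconeMapColim (S : ShortComplex (J ⥤ C)) :
    IsColimit (coconeMapColim S) :=
  isColimitOfIsColimitπ _
    (IsColimit.ofIsoColimit (colimit.isColimit S.X₁)
      (Cocone.ext (Iso.refl _) (fun _ ↦ Category.comp_id _)))
    (IsColimit.ofIsoColimit (colimit.isColimit S.X₂)
      (Cocone.ext (Iso.refl _) (fun _ ↦ Category.comp_id _)))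
    (IsColimit.ofIsoColimit (colimit.isColimit S.X₃)
      (Cocone.ext (Iso.refl _) (fun _ ↦ Category.comp_id _)))

/-- Homology of short complexes of functors is computed pointwise. -/
noncomputable def functorHomologyIso (S : ShortComplex (J ⥤ C)) :
    (FunctorEquivalence.functor J C).obj S ⋙ homologyFunctor C ≅ S.homology :=
  NatIso.ofComponents (fun j ↦ S.mapHomologyIso ((evaluation J C).obj j)) (fun {i j} f ↦ by
    exact (Iso.inv_comp_eq _).1 (NatTrans.app_homology ((evaluation J C).map f) S).symm)

variable [HasExactColimitsOfShape J C]

instance preservesColimitsOfShape_homologyFunctor :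
    PreservesColimitsOfShape J (homologyFunctor C) where
  preservesColimit {F} := by
    let S := (FunctorEquivalence.inverse J C).obj F
    suffices PreservesColimit ((FunctorEquivalence.functor J C).obj S) (homologyFunctor C) from
      have : PreservesColimit ((FunctorEquivalence.inverse J C ⋙
        FunctorEquivalence.functor J C).obj F) (homologyFunctor C) := this
      preservesColimit_of_iso_diagram _ ((FunctorEquivalence.counitIso J C).app F)
    refine preservesColimit_of_preserves_colimit_cocone (isColimitCoconeMapColim S) ?_
    refine (IsColimit.precomposeInvEquiv (functorHomologyIso S) _).1
      (IsColimit.ofIsoColimit (colimit.isColimit S.homology)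
        (Cocone.ext (S.mapHomologyIso colim).symm (fun j ↦ ?_)))
    exact (Iso.comp_inv_eq _).2
      ((NatTrans.app_homology (evaluationToColim j) S).trans (Category.assoc _ _ _).symm)

end CategoryTheory.ShortComplex

namespace HomologicalComplex

variable {ι J C : Type*} [Category* J] [Category* C] [Abelian C] [HasColimitsOfShape J C]
  (c : ComplexShape ι)

instance (i : ι) : PreservesColimitsOfShape J (shortComplexFunctor C c i) where
  preservesColimit := ⟨fun hs ↦ ⟨ShortComplex.isColimitOfIsColimitπ _
    (isColimitOfPreserves (eval C c (c.prev i)) hs) (isColimitOfPreserves (eval C c i) hs)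
    (isColimitOfPreserves (eval C c (c.next i)) hs)⟩⟩

instance preservesColimitsOfShape_homologyFunctor [HasExactColimitsOfShape J C] (i : ι) :
    PreservesColimitsOfShape J (homologyFunctor C c i) :=
  inferInstanceAs (PreservesColimitsOfShape J
    (shortComplexFunctor C c i ⋙ ShortComplex.homologyFunctor C))

end HomologicalComplex

/-! ### Coproducts in the derived category. -/

lemma CategoryTheory.Limits.isIso_map_sigmaMap {C D J : Type*} [Category* C] [Category* D]
    (F : C ⥤ D) [PreservesColimitsOfShape (Discrete J) F] {X Y : J → C} [HasCoproduct X]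
    [HasCoproduct Y] (f : ∀ j, X j ⟶ Y j) [∀ j, IsIso (F.map (f j))] :
    IsIso (F.map (Limits.Sigma.map f)) := by
  have hX := isColimitCofanMkObjOfIsColimit F _ _ (coproductIsCoproduct X)
  have hY := isColimitCofanMkObjOfIsColimit F _ _ (coproductIsCoproduct Y)
  have h (j : J) : F.map (Limits.Sigma.ι X j) ≫ F.map (Limits.Sigma.map f) =
      F.map (f j) ≫ F.map (Limits.Sigma.ι Y j) := by
    rw [← F.map_comp, Limits.Sigma.ι_map, F.map_comp]
  let g : F.obj (∐ Y) ⟶ F.obj (∐ X) :=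
    Cofan.IsColimit.desc hY fun j ↦ inv (F.map (f j)) ≫ F.map (Limits.Sigma.ι X j)
  have hg (j : J) : F.map (Limits.Sigma.ι Y j) ≫ g =
      inv (F.map (f j)) ≫ F.map (Limits.Sigma.ι X j) := Cofan.IsColimit.fac hY _ j
  refine ⟨g, Cofan.IsColimit.hom_ext hX _ _ (fun j ↦ ?_),
    Cofan.IsColimit.hom_ext hY _ _ (fun j ↦ ?_)⟩
  · change F.map (Limits.Sigma.ι X j) ≫ _ = F.map (Limits.Sigma.ι X j) ≫ _
    rw [reassoc_of% (h j), hg, IsIso.hom_inv_id_assoc, Category.comp_id]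
  · change F.map (Limits.Sigma.ι Y j) ≫ _ = F.map (Limits.Sigma.ι Y j) ≫ _
    rw [reassoc_of% (hg j), h, IsIso.inv_hom_id_assoc, Category.comp_id]

namespace DerivedCategory

variable {C : Type u} [Category.{v} C] [Abelian C] [HasDerivedCategory.{w} C]

lemma isZero_Q_obj_iff (K : CochainComplex C ℤ) :
    IsZero (Q.obj K) ↔ ∀ n, IsZero (K.homology n) := by
  have h : IsZero (Q.obj K) ↔ ∀ n, IsZero ((homologyFunctor C n).obj (Q.obj K)) := by
    refine ⟨fun h n ↦ Functor.map_isZero _ h, fun h ↦ ?_⟩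
    have : IsIso (0 : Q.obj K ⟶ Q.obj K) := by
      rw [isIso_iff]
      exact fun n ↦ ⟨0, (h n).eq_of_src _ _, (h n).eq_of_src _ _⟩
    rw [IsZero.iff_id_eq_zero, ← cancel_mono (0 : Q.obj K ⟶ Q.obj K)]
    simp
  exact h.trans (forall_congr' fun n ↦ ((homologyFunctorFactors C n).app K).isZero_iff)

/-- A morphism of complexes which vanishes in the derived category factors, after precomposition
with a quasi-isomorphism, through an acyclic complex. -/
lemma exists_fac_of_Q_map_eq_zero {K L : CochainComplex C ℤ} (f : K ⟶ L) (hf : Q.map f = 0) :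
    ∃ (K' A : CochainComplex C ℤ) (s : K' ⟶ K) (a : K' ⟶ A) (b : A ⟶ L),
      IsIso (Q.map s) ∧ IsZero (Q.obj A) ∧ s ≫ f = a ≫ b := by
  have hf' : Qh.map ((HomotopyCategory.quotient C (.up ℤ)).map f) =
      Qh.map ((HomotopyCategory.quotient C (.up ℤ)).map 0) := by
    rw [Functor.map_zero, Functor.map_zero]
    have := quotientCompQhIso_hom_naturality f
    rw [hf, comp_zero] at this
    rwa [← cancel_mono ((quotientCompQhIso C).hom.app L), zero_comp]
  rw [MorphismProperty.map_eq_iff_precomp Qh (HomotopyCategory.quasiIso C (.up ℤ))] at hf'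
  obtain ⟨K', s, hs, fac⟩ := hf'
  obtain ⟨K', rfl⟩ := HomotopyCategory.quotient_obj_surjective K'
  obtain ⟨s, rfl⟩ := (HomotopyCategory.quotient _ _).map_surjective s
  rw [← isIso_Qh_map_iff] at hs
  rw [Functor.map_zero, comp_zero, ← Functor.map_comp,
    HomotopyCategory.quotient_map_eq_zero_iff] at fac
  obtain ⟨h⟩ := fac
  -- A null-homotopic morphism out of `K'` extends to the cone of `𝟙 K'`, which is contractible.
  refine ⟨K', CochainComplex.mappingCone (𝟙 K'), s, CochainComplex.mappingCone.inr _,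
    HomologicalComplex.homotopyCofiber.desc (𝟙 K') (s ≫ f)
      ((Homotopy.ofEq (by simp)).trans h), hs, ?_, ?_⟩
  · rw [IsZero.iff_id_eq_zero, ← Q.map_id, ← Q.map_zero]
    exact Q_map_eq_of_homotopy _ (CochainComplex.mappingCone.homotopyToZeroOfId K')
  · exact (HomologicalComplex.homotopyCofiber.inr_desc _ _ _).symm

section

variable {J : Type*} [HasColimitsOfShape (Discrete J) C]
  [HasExactColimitsOfShape (Discrete J) C]

lemma isZero_Q_obj_sigma (X : J → CochainComplex C ℤ) (hX : ∀ j, IsZero (Q.obj (X j))) :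
    IsZero (Q.obj (∐ X)) := by
  simp only [isZero_Q_obj_iff] at hX ⊢
  intro n
  have h := isColimitCofanMkObjOfIsColimit (HomologicalComplex.homologyFunctor C (.up ℤ) n) _ _
    (coproductIsCoproduct X)
  rw [IsZero.iff_id_eq_zero]
  exact Cofan.IsColimit.hom_ext h _ _ (fun j ↦ (hX j n).eq_of_src _ _)

lemma isIso_Q_map_sigmaMap {X Y : J → CochainComplex C ℤ} (f : ∀ j, X j ⟶ Y j)
    [hf : ∀ j, IsIso (Q.map (f j))] : IsIso (Q.map (Limits.Sigma.map f)) := by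
  rw [isIso_Q_map_iff_quasiIso, quasiIso_iff]
  intro n
  rw [quasiIsoAt_iff_isIso_homologyMap]
  have (j : J) : IsIso ((HomologicalComplex.homologyFunctor C (.up ℤ) n).map (f j)) := by
    have := hf j
    rw [isIso_Q_map_iff_quasiIso, quasiIso_iff] at this
    exact (quasiIsoAt_iff_isIso_homologyMap _ _).1 (this n)
  exact isIso_map_sigmaMap (HomologicalComplex.homologyFunctor C (.up ℤ) n) f

/-- Write the morphism as a left fraction. Each restriction of its numerator vanishes in `D(C)`, so
up to a quasi-isomorphism it factors through an acyclic complex. Coproducts of quasi-isomorphisms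
and of acyclic complexes are again such, so the factorizations can be summed. -/
lemma hom_ext_Q_obj_sigma (X : J → CochainComplex C ℤ) {Y : DerivedCategory C}
    (f g : Q.obj (∐ X) ⟶ Y)
    (h : ∀ j, Q.map (Limits.Sigma.ι X j) ≫ f = Q.map (Limits.Sigma.ι X j) ≫ g) : f = g := by
  suffices ∀ (L : CochainComplex C ℤ) (f : Q.obj (∐ X) ⟶ Q.obj L)
      (_ : ∀ j, Q.map (Limits.Sigma.ι X j) ≫ f = 0), f = 0 by
    rw [← sub_eq_zero, ← cancel_mono (Q.objObjPreimageIso Y).inv, zero_comp]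
    exact this _ _ (fun j ↦ by rw [← Category.assoc, Preadditive.comp_sub, h, sub_self, zero_comp])
  clear h f g Y
  intro L f hf
  obtain ⟨L', g, s, hs, rfl⟩ := left_fac f
  have hg (j) : Q.map (Limits.Sigma.ι X j ≫ g) = 0 := by
    rw [← cancel_mono (inv (Q.map s)), zero_comp, Functor.map_comp, Category.assoc, hf]
  choose X' A t a b ht hA fac using fun j ↦ exists_fac_of_Q_map_eq_zero _ (hg j)
  have := isIso_Q_map_sigmaMap t
  have fac' : Limits.Sigma.map t ≫ g = Limits.Sigma.map a ≫ Limits.Sigma.desc b :=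
    Limits.Sigma.hom_ext _ _ (by simp [fac])
  have : Q.map g = 0 := by
    rw [← cancel_epi (Q.map (Limits.Sigma.map t)), ← Q.map_comp, fac', Q.map_comp, comp_zero,
      (isZero_Q_obj_sigma A hA).eq_of_src (Q.map (Limits.Sigma.desc b)) 0, comp_zero]
  rw [this, zero_comp]

/-- Represent each component by a right fraction; the coproduct of the denominators is still a
quasi-isomorphism, hence a common denominator. -/
lemma exists_desc_Q_obj_sigma (X : J → CochainComplex C ℤ) {Y : DerivedCategory C}
    (f : ∀ j, Q.obj (X j) ⟶ Y) :
    ∃ g : Q.obj (∐ X) ⟶ Y, ∀ j, Q.map (Limits.Sigma.ι X j) ≫ g = f j := by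
  suffices ∀ (L : CochainComplex C ℤ) (f : ∀ j, Q.obj (X j) ⟶ Q.obj L),
      ∃ g : Q.obj (∐ X) ⟶ Q.obj L, ∀ j, Q.map (Limits.Sigma.ι X j) ≫ g = f j by
    obtain ⟨g, hg⟩ := this _ (fun j ↦ f j ≫ (Q.objObjPreimageIso Y).inv)
    exact ⟨g ≫ (Q.objObjPreimageIso Y).hom, fun j ↦ by simp [reassoc_of% hg]⟩
  clear f Y
  intro L f
  choose X' s hs g fac using fun j ↦ right_fac (f j)
  have := isIso_Q_map_sigmaMap s
  refine ⟨inv (Q.map (Limits.Sigma.map s)) ≫ Q.map (Limits.Sigma.desc g), fun j ↦ ?_⟩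
  rw [fac, ← cancel_epi (Q.map (s j)), ← Q.map_comp_assoc, ← Limits.Sigma.ι_map, Q.map_comp_assoc,
    IsIso.hom_inv_id_assoc, IsIso.hom_inv_id_assoc, ← Q.map_comp, Limits.Sigma.ι_desc]

/-- Coproducts in the derived category are computed on complexes. -/
noncomputable def isColimitCofanQ (X : J → CochainComplex C ℤ) :
    IsColimit (Cofan.mk (Q.obj (∐ X)) fun j ↦ Q.map (Limits.Sigma.ι X j)) :=
  Cofan.IsColimit.mk _ (fun s ↦ (exists_desc_Q_obj_sigma X s.inj).choose)
    (fun s ↦ (exists_desc_Q_obj_sigma X s.inj).choose_spec)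
    (fun s _ hm ↦ hom_ext_Q_obj_sigma X _ _ (fun j ↦ (hm j).trans
      ((exists_desc_Q_obj_sigma X s.inj).choose_spec j).symm))

/-- Any discrete diagram in the derived category lifts to complexes. -/
noncomputable def discreteFunctorIso (F : Discrete J ⥤ DerivedCategory C) :
    Discrete.functor (fun j ↦ Q.obj (Q.objPreimage (F.obj ⟨j⟩))) ≅ F :=
  Discrete.natIso fun j ↦ Q.objObjPreimageIso (F.obj j)

variable (J C) in
lemma hasColimitsOfShape_discrete : HasColimitsOfShape (Discrete J) (DerivedCategory C) where
  has_colimit F :=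
    have : HasColimit (Discrete.functor (fun j ↦ Q.obj (Q.objPreimage (F.obj ⟨j⟩)))) :=
      ⟨⟨_, isColimitCofanQ (fun j ↦ Q.objPreimage (F.obj ⟨j⟩))⟩⟩
    hasColimit_of_iso (discreteFunctorIso F).symm

instance preservesCoproductsOfShape_homologyFunctor (n : ℤ) :
    PreservesColimitsOfShape (Discrete J) (homologyFunctor C n) where
  preservesColimit {F} := by
    let X (j : J) := Q.objPreimage (F.obj ⟨j⟩)
    suffices PreservesColimit (Discrete.functor (fun j ↦ Q.obj (X j))) (homologyFunctor C n) from
      preservesColimit_of_iso_diagram _ (discreteFunctorIso F)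
    refine preservesColimit_of_preserves_colimit_cocone (isColimitCofanQ X) ?_
    have h := isColimitOfPreserves (HomologicalComplex.homologyFunctor C (.up ℤ) n)
      (coproductIsCoproduct X)
    let e : Discrete.functor (fun j ↦ Q.obj (X j)) ⋙ homologyFunctor C n ≅
        Discrete.functor X ⋙ HomologicalComplex.homologyFunctor C (.up ℤ) n :=
      Discrete.natIso (fun j ↦ (homologyFunctorFactors C n).app (X j.as))
    refine (IsColimit.precomposeInvEquiv e _).1
      (IsColimit.ofIsoColimit h (Cocone.ext ((homologyFunctorFactors C n).symm.app (∐ X))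
        (fun ⟨j⟩ ↦ ?_)))
    exact (homologyFunctorFactors C n).inv.naturality (Limits.Sigma.ι X j)

end

end DerivedCategory

/-! ### The heart of a t-structure is abelian. -/

lemma CategoryTheory.Pretriangulated.distinguished_of_iso {C : Type*} [Category* C]
    [Preadditive C] [HasZeroObject C] [HasShift C ℤ] [∀ n : ℤ, (shiftFunctor C n).Additive]
    [Pretriangulated C] {X₁ X₂ X₃ Y₁ Y₂ Y₃ : C} {f : X₁ ⟶ X₂} {g : X₂ ⟶ X₃} {h : X₃ ⟶ X₁⟦(1 : ℤ)⟧}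
    {f' : Y₁ ⟶ Y₂} {g' : Y₂ ⟶ Y₃} {h' : Y₃ ⟶ Y₁⟦(1 : ℤ)⟧} (hT : Triangle.mk f g h ∈ distTriang C)
    (e₁ : Y₁ ≅ X₁) (e₂ : Y₂ ≅ X₂) (e₃ : Y₃ ≅ X₃) (comm₁ : f' ≫ e₂.hom = e₁.hom ≫ f)
    (comm₂ : g' ≫ e₃.hom = e₂.hom ≫ g) (comm₃ : h' ≫ e₁.hom⟦(1 : ℤ)⟧' = e₃.hom ≫ h) :
    Triangle.mk f' g' h' ∈ distTriang C :=
  isomorphic_distinguished _ hT _ (Triangle.isoMk _ _ e₁ e₂ e₃ comm₁ comm₂ comm₃)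

namespace CategoryTheory.Triangulated.TStructure

variable {C : Type*} [Category* C] [Preadditive C] [HasZeroObject C] [HasShift C ℤ]
  [∀ n : ℤ, (shiftFunctor C n).Additive] [Pretriangulated C] (t : TStructure C)

lemma isLE_of_heart (X : t.heart.FullSubcategory) : t.IsLE X.obj 0 := ⟨X.property.1⟩

lemma isGE_of_heart (X : t.heart.FullSubcategory) : t.IsGE X.obj 0 := ⟨X.property.2⟩

lemma heart_hom_shift_eq_zero ⦃X Y : t.heart.FullSubcategory⦄ ⦃n : ℤ⦄
    (f : t.heart.ι.obj X ⟶ (t.heart.ι.obj Y)⟦n⟧) (hn : n < 0) : f = 0 := by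
  have := t.isLE_of_heart X
  have := t.isGE_of_heart Y
  exact t.zero_of_isLE_of_isGE f 0 (-n) (by lia) ‹_› (t.isGE_shift Y.obj 0 n (-n) (by lia))

/-- The cone of a morphism of the heart lies in degrees `[-1, 0]`. Its truncation triangle has the
form `K⟦1⟧ ⟶ X₃ ⟶ Q₀` with `K` and `Q₀` in the heart; these are the kernel and the cokernel. -/
lemma heart_admissibleMorphism :
    AbelianSubcategory.admissibleMorphism t.heart.ι = ⊤ := by
  ext X₁ X₂ f
  simp only [MorphismProperty.top_apply, iff_true]
  intro X₃ f₂ f₃ hT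
  have h₁ := t.isLE_of_heart X₁
  have h₂ := t.isLE_of_heart X₂
  have h₁' := t.isGE_of_heart X₁
  have h₂' := t.isGE_of_heart X₂
  have h₃ := t.isLE_shift X₁.obj 0 1 (-1)
  have h₃' := t.isGE_shift X₁.obj 0 1 (-1)
  have hLE : t.IsLE X₃ 0 := t.isLE₂ _ (rot_of_distTriang _ hT) 0 h₂
    (t.isLE_of_le (X₁.obj⟦(1 : ℤ)⟧) (-1) 0)
  have hGE : t.IsGE X₃ (-1) := t.isGE₂ _ (rot_of_distTriang _ hT) (-1)
    (t.isGE_of_ge X₂.obj (-1) 0) h₃'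
  obtain ⟨A, Q, hA, hQ, α, β, γ, hT'⟩ := t.exists_triangle X₃ (-1) 0 (by lia)
  have hA : t.IsLE A (-1) := ⟨hA⟩
  have hQ : t.IsGE Q 0 := ⟨hQ⟩
  have hQ₁ := t.isGE_shift Q 0 (-1) 1
  have hA₁ := t.isLE_shift A (-1) 1 (-2)
  have hA' : t.IsGE A (-1) := t.isGE₂ _ (inv_rot_of_distTriang _ hT') (-1)
    (t.isGE_of_ge (Q⟦(-1 : ℤ)⟧) (-1) 1) hGE
  have hQ' : t.IsLE Q 0 := t.isLE₂ _ (rot_of_distTriang _ hT') 0 hLE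
    (t.isLE_of_le (A⟦(1 : ℤ)⟧) (-2) 0)
  let K : t.heart.FullSubcategory :=
    ⟨A⟦(-1 : ℤ)⟧, (t.isLE_shift A (-1) (-1) 0).le, (t.isGE_shift A (-1) (-1) 0).ge⟩
  let Q₀ : t.heart.FullSubcategory := ⟨Q, hQ'.le, hQ.ge⟩
  let e : (t.heart.ι.obj K)⟦(1 : ℤ)⟧ ≅ A := (shiftEquiv C (1 : ℤ)).counitIso.app A
  refine ⟨K, Q₀, e.hom ≫ α, β, γ ≫ (shiftFunctor C (1 : ℤ)).map e.inv, ?_⟩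
  exact distinguished_of_iso hT' e (Iso.refl _) (Iso.refl _)
    (by simp) (by simp) (by simp [← Functor.map_comp])

lemma isGE_of_isLimit {J : Type*} [Category* J] {F : J ⥤ C} {c : Cone F} (hc : IsLimit c) (n : ℤ)
    (hF : ∀ j, t.IsGE (F.obj j) n) : t.IsGE c.pt n := by
  rw [t.isGE_iff_orthogonal (n - 1) n (by lia)]
  exact fun Y f _ ↦ hc.hom_ext fun j ↦ by rw [zero_comp]; exact t.zero _ (n - 1) n

lemma isLE_of_isColimit {J : Type*} [Category* J] {F : J ⥤ C} {c : Cocone F} (hc : IsColimit c)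
    (n : ℤ) (hF : ∀ j, t.IsLE (F.obj j) n) : t.IsLE c.pt n := by
  rw [t.isLE_iff_orthogonal n (n + 1) rfl]
  exact fun Y f _ ↦ hc.hom_ext fun j ↦ by rw [comp_zero]; exact t.zero _ n (n + 1)

/-- By orthogonality, the co-aisle is stable under limits and the aisle under colimits; a finite
product is also a coproduct. -/
instance : t.heart.IsClosedUnderFiniteProducts where
  isClosedUnderLimitsOfShape J _ := by
    refine .mk' ?_
    rintro X ⟨F, hF⟩
    refine ⟨?_, (t.isGE_of_isLimit (limit.isLimit F) 0 fun j ↦ ⟨(hF j).2⟩).ge⟩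
    have : t.IsLE (colim.obj F) 0 :=
      t.isLE_of_isColimit (colimit.isColimit F) 0 fun j ↦ ⟨(hF j).1⟩
    exact (t.isLE_of_iso (HasBiproductsOfShape.colimIsoLim.app F) 0).le

/-- The heart of a t-structure is abelian. -/
@[reducible]
noncomputable def abelianHeart [IsTriangulated C] : Abelian t.heart.FullSubcategory :=
  AbelianSubcategory.abelian t.heart.ι t.heart_hom_shift_eq_zero t.heart_admissibleMorphism

attribute [local instance] abelianHeart

/-- An epimorphism of the heart completes to a triangle whose first object is a kernel; uniqueness
of kernels transports this triangle to the given sequence. -/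
lemma exists_distTriang_of_shortExact [IsTriangulated C]
    {S : ShortComplex t.heart.FullSubcategory} (hS : S.ShortExact) :
    ∃ δ : S.X₃.obj ⟶ S.X₁.obj⟦(1 : ℤ)⟧,
      Triangle.mk (t.heart.ι.map S.f) (t.heart.ι.map S.g) δ ∈ distTriang C := by
  have := hS.epi_g
  obtain ⟨X₁, i, δ, hT⟩ := AbelianSubcategory.exists_distinguished_triangle_of_epi
    t.heart_hom_shift_eq_zero t.heart_admissibleMorphism S.g
  have h₁ := AbelianSubcategory.isLimitKernelForkOfDistTriang t.heart_hom_shift_eq_zero _ _ _ hT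
  let e : S.X₁ ≅ X₁ := IsLimit.conePointUniqueUpToIso hS.fIsKernel h₁
  have he : e.hom ≫ i = S.f := IsLimit.conePointUniqueUpToIso_hom_comp hS.fIsKernel h₁
    WalkingParallelPair.zero
  refine ⟨δ ≫ (t.heart.ι.map e.inv)⟦1⟧', ?_⟩
  refine distinguished_of_iso hT (t.heart.ι.mapIso e) (Iso.refl _) (Iso.refl _) ?_ ?_ ?_
  · simp [← he]
  · simp
  · simp [← Functor.map_comp, ← ObjectProperty.FullSubcategory.comp_hom]

end CategoryTheory.Triangulated.TStructure

/-! ### The cokernel of the colimit-defining morphism is the colimit. -/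

section

variable {C D I : Type*} [Category* C] [Category* D] [Preadditive C] [Preadditive D]
  [PartialOrder I] (M : I ⥤ C)
  {c₂ : Cofan fun p : {p : I × I // p.1 ≤ p.2} ↦ M.obj p.1.1} (hc₂ : IsColimit c₂)
  (c₁ : Cofan M.obj) (hc₁ : IsColimit c₁)

lemma inj_colimitDefiningMorphism (p : {p : I × I // p.1 ≤ p.2}) :
    c₂.inj p ≫ colimitDefiningMorphism M hc₂ c₁ =
      c₁.inj p.1.1 - M.map (homOfLE p.2) ≫ c₁.inj p.1.2 :=
  Cofan.IsColimit.fac _ _ _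

lemma inj_colimitDefiningMorphism_assoc (p : {p : I × I // p.1 ≤ p.2}) {Y : C} (g : c₁.pt ⟶ Y) :
    c₂.inj p ≫ colimitDefiningMorphism M hc₂ c₁ ≫ g =
      (c₁.inj p.1.1 - M.map (homOfLE p.2) ≫ c₁.inj p.1.2) ≫ g := by
  rw [← Category.assoc, inj_colimitDefiningMorphism]

/-- If `q : ∐_i M_i ⟶ Z` is a cokernel of the colimit-defining morphism, then `Z` is the colimit
of the direct system. -/
noncomputable def isColimitColimitDefiningCocone {Z : C} (q : c₁.pt ⟶ Z)
    (w : colimitDefiningMorphism M hc₂ c₁ ≫ q = 0) (hq : IsColimit (CokernelCofork.ofπ q w)) :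
    IsColimit (colimitDefiningCocone M hc₂ c₁ q w) := by
  have key (s : Cocone M) : colimitDefiningMorphism M hc₂ c₁ ≫
      Cofan.IsColimit.desc hc₁ s.ι.app = 0 := by
    refine Cofan.IsColimit.hom_ext hc₂ _ _ (fun p ↦ ?_)
    rw [inj_colimitDefiningMorphism_assoc, Preadditive.sub_comp, Category.assoc,
      Cofan.IsColimit.fac, Cofan.IsColimit.fac, comp_zero, s.w, sub_self]
  have fac (s : Cocone M) : q ≫ hq.desc (CokernelCofork.ofπ _ (key s)) =
      Cofan.IsColimit.desc hc₁ s.ι.app := hq.fac (CokernelCofork.ofπ _ (key s)) .one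
  exact
    { desc s := hq.desc (CokernelCofork.ofπ _ (key s))
      fac s i := by
        change (c₁.inj i ≫ q) ≫ _ = _
        rw [Category.assoc, fac, Cofan.IsColimit.fac]
      uniq s m hm := by
        refine Cofork.IsColimit.hom_ext hq ?_
        refine Eq.trans ?_ (fac s).symm
        refine Cofan.IsColimit.hom_ext hc₁ _ _ (fun i ↦ ?_)
        rw [Cofan.IsColimit.fac]
        exact (Category.assoc _ _ _).symm.trans (hm i) }

/-- The image of a cofan by a functor, as a cofan. -/
abbrev CategoryTheory.Functor.mapCofan (F : C ⥤ D) {ι : Type*} {X : ι → C} (c : Cofan X) :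
    Cofan fun i ↦ F.obj (X i) :=
  Cofan.mk (F.obj c.pt) fun i ↦ F.map (c.inj i)

/-- The image of a colimit cofan by a functor which preserves coproducts. -/
noncomputable def CategoryTheory.Functor.isColimitMapCofan (F : C ⥤ D) {ι : Type*}
    [PreservesColimitsOfShape (Discrete ι) F] {X : ι → C} {c : Cofan X} (hc : IsColimit c) :
    IsColimit (F.mapCofan c) :=
  Cofan.isColimitMapCoconeEquiv F X c (isColimitOfPreserves F hc)

lemma map_colimitDefiningMorphism (F : C ⥤ D) [F.Additive]
    (hc₂' : IsColimit (F.mapCofan c₂)) :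
    F.map (colimitDefiningMorphism M hc₂ c₁) =
      colimitDefiningMorphism (M ⋙ F) hc₂' (F.mapCofan c₁) := by
  refine Cofan.IsColimit.hom_ext hc₂' _ _ (fun p ↦ ?_)
  refine Eq.trans ?_ (inj_colimitDefiningMorphism (M ⋙ F) hc₂' (F.mapCofan c₁) p).symm
  change F.map (c₂.inj p) ≫ _ = F.map (c₁.inj p.1.1) - F.map _ ≫ F.map (c₁.inj p.1.2)
  rw [← F.map_comp, inj_colimitDefiningMorphism, F.map_sub, F.map_comp]

end

/-! ### Direct limits in the heart as truncated cones. -/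

namespace CategoryTheory.Triangulated.TStructure

variable {C : Type*} [Category* C] [Preadditive C] [HasZeroObject C] [HasShift C ℤ]
  [∀ n : ℤ, (shiftFunctor C n).Additive] [Pretriangulated C]
  (t : TStructure C) {I : Type*} [PartialOrder I]

section

variable (N : I ⥤ C) (hN : ∀ i, t.IsLE (N.obj i) 0)
  {c₂ : Cofan fun p : {p : I × I // p.1 ≤ p.2} ↦ N.obj p.1.1} (hc₂ : IsColimit c₂)
  {c₁ : Cofan N.obj} (hc₁ : IsColimit c₁) {Z : C} (q : c₁.pt ⟶ Z)
  (r : Z ⟶ c₂.pt⟦(1 : ℤ)⟧)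
  (hT : Triangle.mk (colimitDefiningMorphism N hc₂ c₁) q r ∈ distTriang C)

include hN hc₁ hT in
lemma isLE_cone : t.IsLE Z 0 := by
  have := t.isLE_of_isColimit hc₂ 0 fun _ ↦ hN _
  have := t.isLE_shift c₂.pt 0 1 (-1)
  exact t.isLE₂ _ (rot_of_distTriang _ hT) 0 (t.isLE_of_isColimit hc₁ 0 fun _ ↦ hN _)
    (t.isLE_of_le (c₂.pt⟦(1 : ℤ)⟧) (-1) 0)

include hc₁ hT in
-- A compatible family is a morphism on `∐ N_i` killed by the colimit-defining morphism. It
-- therefore extends to the cone, and then to the truncation because the target lies in degrees `≥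
-- 0`.
lemma exists_desc_truncGE_cone {Y : C} (hY : t.IsGE Y 0) (g : ∀ i, N.obj i ⟶ Y)
    (hg : ∀ ⦃i j⦄ (h : i ≤ j), N.map (homOfLE h) ≫ g j = g i) :
    ∃ k : (t.truncGE 0).obj Z ⟶ Y, ∀ i, c₁.inj i ≫ q ≫ (t.truncGEπ 0).app Z ≫ k = g i := by
  have hw : colimitDefiningMorphism N hc₂ c₁ ≫ Cofan.IsColimit.desc hc₁ g = 0 := by
    refine Cofan.IsColimit.hom_ext hc₂ _ _ (fun p ↦ ?_)
    rw [inj_colimitDefiningMorphism_assoc, Preadditive.sub_comp, Category.assoc,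
      Cofan.IsColimit.fac, Cofan.IsColimit.fac, comp_zero, hg p.2, sub_self]
  obtain ⟨k, hk⟩ : ∃ k : Z ⟶ Y, Cofan.IsColimit.desc hc₁ g = q ≫ k :=
    Triangle.yoneda_exact₂ _ hT (Cofan.IsColimit.desc hc₁ g) hw
  refine ⟨t.descTruncGE k 0, fun i ↦ ?_⟩
  rw [t.π_descTruncGE, ← hk, Cofan.IsColimit.fac]

include hN hc₁ hT in
-- The difference of two extensions factors through `c₂.pt⟦1⟧`, which lies in degrees `≤ -1` and so
-- has no nonzero morphism to `Y`.
lemma hom_ext_truncGE_cone {Y : C} (hY : t.IsGE Y 0) {k k' : (t.truncGE 0).obj Z ⟶ Y}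
    (h : ∀ i, c₁.inj i ≫ q ≫ (t.truncGEπ 0).app Z ≫ k =
      c₁.inj i ≫ q ≫ (t.truncGEπ 0).app Z ≫ k') : k = k' := by
  refine t.from_truncGE_obj_ext ?_
  have h₂ := t.isLE_of_isColimit hc₂ 0 fun _ ↦ hN _
  have h₂' := t.isLE_shift c₂.pt 0 1 (-1)
  have hq : q ≫ ((t.truncGEπ 0).app Z ≫ k - (t.truncGEπ 0).app Z ≫ k') = 0 :=
    Cofan.IsColimit.hom_ext hc₁ _ _ (fun i ↦ by
      rw [Preadditive.comp_sub, Preadditive.comp_sub, h, sub_self, comp_zero])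
  obtain ⟨l, hl⟩ : ∃ l : c₂.pt⟦(1 : ℤ)⟧ ⟶ Y,
    (t.truncGEπ 0).app Z ≫ k - (t.truncGEπ 0).app Z ≫ k' = r ≫ l :=
      Triangle.yoneda_exact₃ _ hT _ hq
  rw [← sub_eq_zero, hl, t.zero l (-1) 0, comp_zero]

end

variable [IsTriangulated C] (M : I ⥤ t.heart.FullSubcategory)
  {c₂ : Cofan fun p : {p : I × I // p.1 ≤ p.2} ↦ (M ⋙ t.heart.ι).obj p.1.1} (hc₂ : IsColimit c₂)
  {c₁ : Cofan (M ⋙ t.heart.ι).obj} (hc₁ : IsColimit c₁) {Z : C} (q : c₁.pt ⟶ Z)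
  (r : Z ⟶ c₂.pt⟦(1 : ℤ)⟧)
  (hT : Triangle.mk (colimitDefiningMorphism (M ⋙ t.heart.ι) hc₂ c₁) q r ∈ distTriang C)

/-- The colimit cocone in the heart of a t-structure which is obtained by truncating the cone
of the colimit-defining morphism. -/
noncomputable def heartCocone : Cocone M where
  pt := ⟨(t.truncGE 0).obj Z, by
    have := t.isLE_cone (M ⋙ t.heart.ι) (fun i ↦ t.isLE_of_heart _) hc₂ hc₁ q r hT
    exact ⟨(inferInstance : t.IsLE ((t.truncGE 0).obj Z) 0).le,
      (inferInstance : t.IsGE ((t.truncGE 0).obj Z) 0).ge⟩⟩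
  ι :=
    { app i := ObjectProperty.homMk (c₁.inj i ≫ q ≫ (t.truncGEπ 0).app Z)
      naturality i j f := by
        ext
        have := map_comp_inj_comp (M ⋙ t.heart.ι) hc₂ c₁ (q ≫ (t.truncGEπ 0).app Z) (by
          have h : colimitDefiningMorphism (M ⋙ t.heart.ι) hc₂ c₁ ≫ q = 0 :=
            comp_distTriang_mor_zero₁₂ _ hT
          rw [← Category.assoc, h, zero_comp]) (leOfHom f)
        exact this.trans (Category.comp_id _).symm }

/-- `heartCocone` is a colimit cocone. -/
noncomputable def isColimitHeartCocone : IsColimit (t.heartCocone M hc₂ hc₁ q r hT) := by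
  have key (s : Cocone M) := t.exists_desc_truncGE_cone (M ⋙ t.heart.ι) hc₂ hc₁ q r hT
    (t.isGE_of_heart s.pt) (fun i ↦ (s.ι.app i).hom)
    (fun i j h ↦ congr_arg InducedCategory.Hom.hom (s.w (homOfLE h)))
  exact
    { desc s := ObjectProperty.homMk (key s).choose
      fac s i := by
        ext
        refine Eq.trans ?_ ((key s).choose_spec i)
        exact (Category.assoc _ _ _).trans (congr_arg (c₁.inj i ≫ ·) (Category.assoc _ _ _))
      uniq s m hm := by
        ext
        refine t.hom_ext_truncGE_cone (M ⋙ t.heart.ι)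
          (fun i ↦ t.isLE_of_heart _) hc₂ hc₁ q r hT (t.isGE_of_heart s.pt) (fun i ↦ ?_)
        refine Eq.trans ?_ ((key s).choose_spec i).symm
        refine Eq.trans ?_ (congr_arg InducedCategory.Hom.hom (hm i))
        exact ((Category.assoc _ _ _).trans
          (congr_arg (c₁.inj i ≫ ·) (Category.assoc _ _ _))).symm }

include hT hc₁ in
lemma exists_iso_of_isColimit {c : Cocone M} (hc : IsColimit c) :
    ∃ (e : (t.truncGE 0).obj Z ≅ c.pt.obj),
      ∀ i, c₁.inj i ≫ q ≫ (t.truncGEπ 0).app Z ≫ e.hom = (c.ι.app i).hom := by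
  have h := t.isColimitHeartCocone M hc₂ hc₁ q r hT
  refine ⟨t.heart.ι.mapIso (h.coconePointUniqueUpToIso hc), fun i ↦ ?_⟩
  refine Eq.trans ?_
    (congr_arg InducedCategory.Hom.hom (h.comp_coconePointUniqueUpToIso_hom hc i))
  exact ((Category.assoc _ _ _).trans
    (congr_arg (c₁.inj i ≫ ·) (Category.assoc _ _ _))).symm

lemma hasColimit_heart [HasCoproduct fun p : {p : I × I // p.1 ≤ p.2} ↦ (M ⋙ t.heart.ι).obj p.1.1]
    [HasCoproduct (M ⋙ t.heart.ι).obj] : HasColimit M := by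
  obtain ⟨Z, q, r, hT⟩ := distinguished_cocone_triangle (colimitDefiningMorphism (M ⋙ t.heart.ι)
    (coproductIsCoproduct _) (Cofan.mk _ (Limits.Sigma.ι (M ⋙ t.heart.ι).obj)))
  exact ⟨_, t.isColimitHeartCocone M _ (coproductIsCoproduct _) q r hT⟩

end CategoryTheory.Triangulated.TStructure

/-! ### Exact colimits: exact sequences, monomorphisms and kernels. -/

section

variable {J C : Type*} [Category* J] [Category* C] [Abelian C] [HasColimitsOfShape J C]
  [HasExactColimitsOfShape J C]

lemma CategoryTheory.ShortComplex.exact_pt_of_isColimit {F : J ⥤ ShortComplex C} {c : Cocone F}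
    (hc : IsColimit c) (hF : ∀ j, (F.obj j).Exact) : c.pt.Exact := by
  rw [ShortComplex.exact_iff_isZero_homology, IsZero.iff_id_eq_zero]
  refine (isColimitOfPreserves (ShortComplex.homologyFunctor C) hc).hom_ext fun j ↦ ?_
  exact ((ShortComplex.exact_iff_isZero_homology _).1 (hF j)).eq_of_src _ _

/-- Colimits of exact sequences are exact, when colimits of shape `J` are exact. -/
lemma CategoryTheory.Limits.exact_of_isColimit {F₁ F₂ F₃ : J ⥤ C} (α : F₁ ⟶ F₂) (β : F₂ ⟶ F₃)
    (hαβ : ∀ j, α.app j ≫ β.app j = 0) (hex : ∀ j, (ShortComplex.mk _ _ (hαβ j)).Exact)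
    {c₁ : Cocone F₁} {c₂ : Cocone F₂} {c₃ : Cocone F₃} (hc₁ : IsColimit c₁) (hc₂ : IsColimit c₂)
    (hc₃ : IsColimit c₃) (f : c₁.pt ⟶ c₂.pt) (g : c₂.pt ⟶ c₃.pt)
    (hf : ∀ j, c₁.ι.app j ≫ f = α.app j ≫ c₂.ι.app j)
    (hg : ∀ j, c₂.ι.app j ≫ g = β.app j ≫ c₃.ι.app j) (hfg : f ≫ g = 0) :
    (ShortComplex.mk f g hfg).Exact := by
  let F : J ⥤ ShortComplex C :=
    { obj j := .mk _ _ (hαβ j)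
      map k := { τ₁ := F₁.map k, τ₂ := F₂.map k, τ₃ := F₃.map k } }
  let c : Cocone F :=
    { pt := .mk f g hfg
      ι :=
        { app j := { τ₁ := c₁.ι.app j, τ₂ := c₂.ι.app j, τ₃ := c₃.ι.app j
                     comm₁₂ := hf j, comm₂₃ := hg j }
          naturality i j k := by
            ext
            · exact c₁.ι.naturality k
            · exact c₂.ι.naturality k
            · exact c₃.ι.naturality k } }
  have hc : IsColimit c := ShortComplex.isColimitOfIsColimitπ _
    (IsColimit.ofIsoColimit hc₁ (Cocone.ext (Iso.refl _) (fun _ ↦ Category.comp_id _)))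
    (IsColimit.ofIsoColimit hc₂ (Cocone.ext (Iso.refl _) (fun _ ↦ Category.comp_id _)))
    (IsColimit.ofIsoColimit hc₃ (Cocone.ext (Iso.refl _) (fun _ ↦ Category.comp_id _)))
  exact ShortComplex.exact_pt_of_isColimit hc hex

/-- Colimits of monomorphisms are monomorphisms, when colimits of shape `J` are exact. -/
lemma CategoryTheory.Limits.mono_of_isColimit {F₁ F₂ : J ⥤ C} (α : F₁ ⟶ F₂)
    (hα : ∀ j, Mono (α.app j)) {c₁ : Cocone F₁} {c₂ : Cocone F₂} (hc₁ : IsColimit c₁)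
    (hc₂ : IsColimit c₂) (f : c₁.pt ⟶ c₂.pt) (hf : ∀ j, c₁.ι.app j ≫ f = α.app j ≫ c₂.ι.app j) :
    Mono f := by
  have h := exact_of_isColimit (0 : F₁ ⟶ F₁) α (by simp)
    (fun j ↦ (ShortComplex.exact_iff_mono _ rfl).2 (hα j)) hc₁ hc₁ hc₂ 0 f (by simp) hf (by simp)
  exact (ShortComplex.exact_iff_mono _ rfl).1 h

section

variable {E : J ⥤ C} (c : Cocone E) {Q : C} (φ : c.pt ⟶ Q)

/-- The kernels of the restrictions of a morphism from the point of a cocone. -/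
@[simps]
noncomputable def CategoryTheory.Limits.Cocone.kernelDiagram : J ⥤ C where
  obj j := kernel (c.ι.app j ≫ φ)
  map f := kernel.lift _ (kernel.ι _ ≫ E.map f) (by simp)
  map_id j := by ext; simp
  map_comp f g := by ext; simp

/-- The inclusion of the diagram of the kernels of the restrictions of a morphism. -/
@[simps]
noncomputable def CategoryTheory.Limits.Cocone.kernelDiagramι : c.kernelDiagram φ ⟶ E where
  app j := kernel.ι (c.ι.app j ≫ φ)
  naturality _ _ _ := kernel.lift_ι _ _ _

/-- The cocone with point the kernel of a morphism `φ` on the diagram of the kernels of the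
restrictions of `φ`. -/
@[simps]
noncomputable def CategoryTheory.Limits.Cocone.kernelCocone : Cocone (c.kernelDiagram φ) where
  pt := kernel φ
  ι :=
    { app j := kernel.lift φ (kernel.ι (c.ι.app j ≫ φ) ≫ c.ι.app j)
        ((Category.assoc _ _ _).trans (kernel.condition (c.ι.app j ≫ φ)))
      naturality i j f := by
        refine (cancel_mono (kernel.ι φ)).1 ?_
        refine (Category.assoc _ _ _).trans ?_
        rw [kernel.lift_ι]
        refine ((c.kernelDiagramι φ).naturality_assoc f _).trans ?_
        refine Eq.trans ?_ (congr_arg (· ≫ kernel.ι φ) (Category.comp_id _)).symm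
        rw [kernel.lift_ι, c.w]
        rfl }

/-- Pass to the colimit in the exact sequences `0 ⟶ kernel ⟶ E j ⟶ Q`. Connectedness of `J` makes
`Q` the colimit of the constant diagram. -/
lemma CategoryTheory.Limits.Cocone.nonempty_isColimit_kernelCocone [IsConnected J]
    (hc : IsColimit c) : Nonempty (IsColimit (c.kernelCocone φ)) := by
  have hm (j) : colimit.ι (c.kernelDiagram φ) j ≫
      colimit.desc _ (c.kernelCocone φ) ≫ kernel.ι φ = (c.kernelDiagramι φ).app j ≫ c.ι.app j :=
    (colimit.ι_desc_assoc _ _ _).trans (kernel.lift_ι _ _ _)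
  have h₀ : (colimit.desc _ (c.kernelCocone φ) ≫ kernel.ι φ) ≫ φ = 0 :=
    (Category.assoc _ _ _).trans ((congr_arg (_ ≫ ·) (kernel.condition φ)).trans comp_zero)
  let β : E ⟶ (Functor.const J).obj Q := { app j := c.ι.app j ≫ φ }
  have h₁ : Mono (colimit.desc _ (c.kernelCocone φ) ≫ kernel.ι φ) :=
    mono_of_isColimit (c.kernelDiagramι φ)
      (fun j ↦ inferInstanceAs (Mono (kernel.ι (c.ι.app j ≫ φ)))) (colimit.isColimit _) hc _ hm
  have h₂ : (ShortComplex.mk _ _ h₀).Exact :=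
    exact_of_isColimit (c.kernelDiagramι φ) β (fun j ↦ kernel.condition _)
      (fun j ↦ ShortComplex.exact_of_f_is_kernel _ (kernelIsKernel (c.ι.app j ≫ φ)))
      (colimit.isColimit _) hc (isColimitConstCocone J Q) _ _ hm
      (fun j ↦ (Category.comp_id (c.ι.app j ≫ φ)).symm) h₀
  have h₃ : Mono (colimit.desc _ (c.kernelCocone φ)) := mono_of_mono _ (kernel.ι φ)
  have h₄ : Epi (colimit.desc _ (c.kernelCocone φ)) := by
    rw [epi_iff_surjective_up_to_refinements]
    intro A y
    obtain ⟨A', π, hπ, x, hx⟩ := h₂.exact_up_to_refinements (y ≫ kernel.ι φ)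
      ((Category.assoc _ _ _).trans ((congr_arg (y ≫ ·) (kernel.condition φ)).trans comp_zero))
    refine ⟨A', π, hπ, x, (cancel_mono (kernel.ι φ)).1 ?_⟩
    exact (Category.assoc _ _ _).trans (hx.trans (Category.assoc _ _ _).symm)
  have : IsIso ((colimit.isColimit _).desc (c.kernelCocone φ)) :=
    isIso_of_mono_of_epi (colimit.desc _ (c.kernelCocone φ))
  exact ⟨IsColimit.ofPointIso (t := c.kernelCocone φ) (colimit.isColimit _)⟩

end

end

/-! ### Torsion pairs: orthogonality and the torsion-free quotient. -/

namespace TorsionPair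

variable {C : Type u} [Category.{v} C] [Abelian C] (t : TorsionPair C)

instance (X : C) : Mono (t.ι X) := (t.shortExact X).mono_f

instance (X : C) : Epi (t.π X) := (t.shortExact X).epi_g

lemma torsion_iff (X : C) :
    t.torsion X ↔ ∀ ⦃F : C⦄ (_ : t.torsionFree F) (f : X ⟶ F), f = 0 := by
  refine ⟨fun hX F hF f ↦ t.hom_eq_zero f hX hF, fun h ↦ ?_⟩
  have : Epi (t.ι X) := (t.shortExact X).exact.epi_f (h (t.torsionFree_quotient X) _)
  have := isIso_of_mono_of_epi (t.ι X)
  exact t.torsion.prop_of_iso (asIso (t.ι X)) (t.torsion_radical X)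

lemma torsionFree_iff (X : C) :
    t.torsionFree X ↔ ∀ ⦃T : C⦄ (_ : t.torsion T) (f : T ⟶ X), f = 0 := by
  refine ⟨fun hX T hT f ↦ t.hom_eq_zero f hT hX, fun h ↦ ?_⟩
  have : Mono (t.π X) := (t.shortExact X).exact.mono_g (h (t.torsion_radical X) _)
  have := isIso_of_mono_of_epi (t.π X)
  exact t.torsionFree.prop_of_iso (asIso (t.π X)).symm (t.torsionFree_quotient X)

lemma torsion_of_epi {X Y : C} (f : X ⟶ Y) [Epi f] (hX : t.torsion X) : t.torsion Y := by
  rw [torsion_iff]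
  intro F hF g
  rw [← cancel_epi f, t.hom_eq_zero (f ≫ g) hX hF, comp_zero]

lemma torsionFree_of_mono {X Y : C} (f : X ⟶ Y) [Mono f] (hY : t.torsionFree Y) :
    t.torsionFree X := by
  rw [torsionFree_iff]
  intro T hT g
  rw [← cancel_mono f, t.hom_eq_zero (g ≫ f) hT hY, zero_comp]

lemma torsion_of_isColimit {J : Type*} [Category* J] {F : J ⥤ C} {c : Cocone F}
    (hc : IsColimit c) (hF : ∀ j, t.torsion (F.obj j)) : t.torsion c.pt := by
  rw [torsion_iff]
  exact fun Y hY f ↦ hc.hom_ext fun j ↦ by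
    rw [comp_zero]; exact t.hom_eq_zero _ (hF j) hY

/-- Both `t.π` and `S.g` are cokernels of torsion subobjects with torsion-free quotient, and each
kills the kernel of the other because `Hom(𝒯, ℱ) = 0`. -/
lemma exists_iso_quotient {S : ShortComplex C} (hS : S.ShortExact) (h₁ : t.torsion S.X₁)
    (h₃ : t.torsionFree S.X₃) : ∃ e : t.quotient S.X₂ ≅ S.X₃, t.π S.X₂ ≫ e.hom = S.g := by
  have := hS.epi_g
  have h := t.shortExact S.X₂
  have w₁ : t.ι S.X₂ ≫ S.g = 0 := t.hom_eq_zero _ (t.torsion_radical _) h₃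
  have w₂ : S.f ≫ t.π S.X₂ = 0 := t.hom_eq_zero _ h₁ (t.torsionFree_quotient _)
  have f₁ : t.π S.X₂ ≫ h.exact.desc S.g w₁ = S.g := h.exact.g_desc _ _
  have f₂ : S.g ≫ hS.exact.desc (t.π S.X₂) w₂ = t.π S.X₂ := hS.exact.g_desc _ _
  refine ⟨⟨h.exact.desc S.g w₁, hS.exact.desc (t.π S.X₂) w₂, ?_, ?_⟩, f₁⟩
  · refine (cancel_epi (t.π S.X₂)).1 ?_
    exact (Category.assoc _ _ _).symm.trans
      ((congr_arg (· ≫ _) f₁).trans (f₂.trans (Category.comp_id _).symm))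
  · rw [← cancel_epi S.g, reassoc_of% f₂, f₁, Category.comp_id]

/-- If `A` is torsion-free, the cokernel of `a : A ⟶ B` is torsion and splits off, then `A`
identifies to the torsion-free quotient of `B`. -/
lemma isIso_comp_π {A B X : C} (a : A ⟶ B) [Mono a] (δ : B ⟶ X) (w : a ≫ δ = 0)
    (h : (ShortComplex.mk a δ w).Exact) (hA : t.torsionFree A) (hX : t.torsion X) (s : X ⟶ B)
    (hs : s ≫ δ = 𝟙 X) : IsIso (a ≫ t.π B) := by
  let σ := ShortComplex.Splitting.ofExactOfSection (.mk a δ w) h s hs ‹_›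
  have h₁ : a ≫ σ.r = 𝟙 _ := σ.f_r
  have h₃ : σ.r ≫ a + δ ≫ s = 𝟙 _ := σ.id
  have h₂ : s ≫ σ.r = 0 := σ.s_r
  -- Read backwards, the splitting is a short exact sequence with torsion subobject `X` and
  -- torsion-free quotient `A`.
  let τ : (ShortComplex.mk s σ.r h₂).Splitting :=
    { r := δ, s := a, f_r := hs, s_g := h₁, id := by rw [add_comm]; exact h₃ }
  obtain ⟨e, he⟩ := t.exists_iso_quotient τ.shortExact hX hA
  dsimp at he
  have : a ≫ t.π B = e.inv := by
    rw [← cancel_mono e.hom, Category.assoc, he, h₁, e.inv_hom_id]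
  rw [this]
  infer_instance

end TorsionPair

/-! ### Coproducts as direct limits of subcoproducts, and gluing of local sections. -/

section

variable {C I K : Type*} [Category* C] [Abelian C] [PartialOrder I]
  {P : C} (e : I → (P ⟶ P)) (he : ∀ ⦃i j : I⦄, i ≤ j → e i ≫ e j = e i)

/-- The direct system of the images of a directed family of idempotents. -/
@[simps]
noncomputable def CategoryTheory.Limits.fixedDiagram : I ⥤ C where
  obj i := kernel (𝟙 P - e i)
  map {i j} f := kernel.lift _ (kernel.ι (𝟙 P - e i)) (by
    have h : kernel.ι (𝟙 P - e i) ≫ (𝟙 P - e i) = 0 := kernel.condition _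
    rw [Preadditive.comp_sub, Category.comp_id, sub_eq_zero] at h
    rw [Preadditive.comp_sub, Category.comp_id, sub_eq_zero, h, Category.assoc, he (leOfHom f)])
  map_id _ := by ext; simp
  map_comp _ _ := by ext; simp

/-- The inclusion of the image of the idempotent `e i`. -/
noncomputable def CategoryTheory.Limits.fixedι (i : I) : (fixedDiagram e he).obj i ⟶ P :=
  kernel.ι (𝟙 P - e i)

instance (i : I) : Mono (fixedι e he i) := inferInstanceAs (Mono (kernel.ι (𝟙 P - e i)))

lemma CategoryTheory.Limits.fixedDiagram_map_fixedι {i j : I} (f : i ⟶ j) :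
    (fixedDiagram e he).map f ≫ fixedι e he j = fixedι e he i :=
  kernel.lift_ι _ _ _

lemma CategoryTheory.Limits.fixedι_comp (i : I) : fixedι e he i ≫ e i = fixedι e he i := by
  have h : kernel.ι (𝟙 P - e i) ≫ (𝟙 P - e i) = 0 := kernel.condition _
  rw [Preadditive.comp_sub, Category.comp_id, sub_eq_zero] at h
  exact h.symm

/-- The cocone given by the inclusions of the images of a directed family of idempotents. -/
@[simps]
noncomputable def CategoryTheory.Limits.fixedCocone : Cocone (fixedDiagram e he) where
  pt := P
  ι :=
    { app i := fixedι e he i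
      naturality _ _ f := (fixedDiagram_map_fixedι e he f).trans (Category.comp_id _).symm }

/-- The lift of a morphism that is fixed by the idempotent `e i`. -/
noncomputable def CategoryTheory.Limits.fixedLift {X : C} (i : I) (f : X ⟶ P) (hf : f ≫ e i = f) :
    X ⟶ (fixedDiagram e he).obj i :=
  kernel.lift _ f (by rw [Preadditive.comp_sub, Category.comp_id, hf, sub_self])

lemma CategoryTheory.Limits.fixedLift_ι {X : C} (i : I) (f : X ⟶ P) (hf : f ≫ e i = f) :
    fixedLift e he i f hf ≫ fixedι e he i = f :=
  kernel.lift_ι _ _ _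

lemma CategoryTheory.Limits.fixedLift_ι_assoc {X Y : C} (i : I) (f : X ⟶ P) (hf : f ≫ e i = f)
    (g : P ⟶ Y) : fixedLift e he i f hf ≫ fixedι e he i ≫ g = f ≫ g := by
  rw [← Category.assoc, fixedLift_ι]

/-- The images of the projections of a coproduct on its subcoproducts, filtered by
a level function to a directed set, have the coproduct as colimit. -/
lemma CategoryTheory.Limits.nonempty_isColimit_fixedCocone {X : K → C} {inj : ∀ k, X k ⟶ P}
    (hc : IsColimit (Cofan.mk P inj)) (ℓ : K → I) (h₁ : ∀ k i, ℓ k ≤ i → inj k ≫ e i = inj k)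
    (h₂ : ∀ k i, ¬ ℓ k ≤ i → inj k ≫ e i = 0) :
    Nonempty (IsColimit (fixedCocone e he)) := by
  have hi (i) : e i ≫ e i = e i := he le_rfl
  have hom_ext {Y : C} {f g : P ⟶ Y} (h : ∀ k, inj k ≫ f = inj k ≫ g) : f = g :=
    Cofan.IsColimit.hom_ext hc _ _ h
  have key (k) {i j} (hij : i ≤ j) (hk : ℓ k ≤ i) :
      fixedLift e he i (inj k) (h₁ k i hk) ≫ (fixedDiagram e he).map (homOfLE hij) =
        fixedLift e he j (inj k) (h₁ k j (hk.trans hij)) := by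
    rw [← cancel_mono (fixedι e he j), Category.assoc, fixedDiagram_map_fixedι, fixedLift_ι,
      fixedLift_ι]
  -- The summand `X k` already lies in the image of `e (ℓ k)`, so the cocone determines the value
  -- there.
  let d (s : Cocone (fixedDiagram e he)) : P ⟶ s.pt := Cofan.IsColimit.desc hc
    fun k ↦ fixedLift e he (ℓ k) (inj k) (h₁ k _ le_rfl) ≫ s.ι.app (ℓ k)
  have hd (s) (k) : inj k ≫ d s = fixedLift e he (ℓ k) (inj k) (h₁ k _ le_rfl) ≫ s.ι.app (ℓ k) :=
    Cofan.IsColimit.fac hc _ k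
  have hr (i) : fixedι e he i ≫ fixedLift e he i (e i) (hi i) = 𝟙 _ := by
    rw [← cancel_mono (fixedι e he i), Category.assoc, fixedLift_ι,
      fixedι_comp]
    exact (Category.id_comp _).symm
  refine ⟨{ desc := d, fac := fun s i ↦ ?_, uniq := fun s m hm ↦ hom_ext fun k ↦ ?_ }⟩
  -- Since `P` maps onto the image of `e i`, the identity can be tested on `P`, hence summand by
  -- summand.
  · have : IsSplitEpi (fixedLift e he i (e i) (hi i)) := ⟨⟨_, hr i⟩⟩
    rw [← cancel_epi (fixedLift e he i (e i) (hi i))]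
    refine (fixedLift_ι_assoc e he i (e i) (hi i) (d s)).trans ?_
    refine hom_ext fun k ↦ ?_
    by_cases hk : ℓ k ≤ i
    · rw [reassoc_of% (h₁ k i hk), hd, ← s.w (homOfLE hk), ← Category.assoc, ← Category.assoc,
        key k hk le_rfl]
      congr 1
      rw [← cancel_mono (fixedι e he i), Category.assoc, fixedLift_ι, fixedLift_ι,
        h₁ k i hk]
    · have : inj k ≫ fixedLift e he i (e i) (hi i) = 0 := by
        rw [← cancel_mono (fixedι e he i), Category.assoc, fixedLift_ι, zero_comp,
          h₂ k i hk]
      rw [reassoc_of% (h₂ k i hk), reassoc_of% this, zero_comp, zero_comp]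
  · rw [hd, ← hm (ℓ k)]
    exact (fixedLift_ι_assoc e he _ _ _ _).symm

end

/-- If `P` is a coproduct, then the kernel of a morphism `φ : P ⟶ Q` is the colimit of the kernels
of the restrictions of `φ` to the subcoproducts which are given by a level function. -/
lemma CategoryTheory.Limits.exists_kernel_diagram {C I K : Type*} [Category* C] [Abelian C]
    [PartialOrder I] [IsDirectedOrder I] [Nonempty I]
    [HasColimitsOfShape I C] [HasExactColimitsOfShape I C] {P Q : C}
    (e : I → (P ⟶ P)) (he : ∀ ⦃i j : I⦄, i ≤ j → e i ≫ e j = e i)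
    {X : K → C} {inj : ∀ k, X k ⟶ P} (hc : IsColimit (Cofan.mk P inj)) (ℓ : K → I)
    (h₁ : ∀ k i, ℓ k ≤ i → inj k ≫ e i = inj k) (h₂ : ∀ k i, ¬ ℓ k ≤ i → inj k ≫ e i = 0)
    (φ : P ⟶ Q) :
    ∃ (D : I ⥤ C) (y : ∀ i, D.obj i ⟶ kernel φ),
      (∀ ⦃i j⦄ (f : i ⟶ j), D.map f ≫ y j = y i) ∧ (∀ i, Mono (y i)) ∧
      (∀ i, (y i ≫ kernel.ι φ) ≫ e i = y i ≫ kernel.ι φ) ∧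
      (∀ ⦃i⦄ ⦃Y : C⦄ (g : Y ⟶ P), g ≫ e i = g → g ≫ φ = 0 →
        ∃ ρ : Y ⟶ D.obj i, ρ ≫ y i ≫ kernel.ι φ = g) ∧
      (∀ ⦃Y : C⦄ (f g : kernel φ ⟶ Y), (∀ i, y i ≫ f = y i ≫ g) → f = g) ∧
      (∀ ⦃Y : C⦄ (s : ∀ i, D.obj i ⟶ Y), (∀ ⦃i j⦄ (f : i ⟶ j), D.map f ≫ s j = s i) →
        ∃ k : kernel φ ⟶ Y, ∀ i, y i ≫ k = s i) := by
  have : IsConnected I := IsFiltered.isConnected I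
  obtain ⟨hE⟩ := nonempty_isColimit_fixedCocone e he hc ℓ h₁ h₂
  obtain ⟨hZ⟩ := (fixedCocone e he).nonempty_isColimit_kernelCocone φ hE
  have hx (i) : ((fixedCocone e he).kernelCocone φ).ι.app i ≫ kernel.ι φ =
      ((fixedCocone e he).kernelDiagramι φ).app i ≫ fixedι e he i := kernel.lift_ι _ _ _
  refine ⟨(fixedCocone e he).kernelDiagram φ, fun i ↦ ((fixedCocone e he).kernelCocone φ).ι.app i,
    fun i j f ↦ ((fixedCocone e he).kernelCocone φ).w f, fun i ↦ ?_, fun i ↦ ?_,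
    fun i Y g hg hg' ↦ ?_, fun Y f g h ↦ hZ.hom_ext h, fun Y s hs ↦ ?_⟩
  · have h₁ : Mono (((fixedCocone e he).kernelDiagramι φ).app i) :=
      inferInstanceAs (Mono (kernel.ι _))
    have h₂ : Mono (((fixedCocone e he).kernelDiagramι φ).app i ≫ fixedι e he i) := mono_comp _ _
    rw [← hx] at h₂
    exact @mono_of_mono _ _ _ _ _ (((fixedCocone e he).kernelCocone φ).ι.app i) (kernel.ι φ) h₂
  · refine (congr_arg (· ≫ e i) (hx i)).trans (Eq.trans ?_ (hx i).symm)
    exact (Category.assoc _ _ _).trans (congr_arg (_ ≫ ·) (fixedι_comp e he i))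
  · refine ⟨kernel.lift (fixedι e he i ≫ φ) (fixedLift e he i g hg)
      (by rw [fixedLift_ι_assoc, hg']), ?_⟩
    refine (congr_arg (_ ≫ ·) (hx i)).trans ((kernel.lift_ι_assoc _ _ _ _).trans ?_)
    exact fixedLift_ι _ _ _ _ _
  · exact ⟨hZ.desc
      { pt := Y
        ι :=
          { app := s
            naturality i j f := (hs f).trans (Category.comp_id _).symm } }, fun i ↦ hZ.fac _ i⟩

/-- Let `0 ⟶ A ⟶ B ⟶ P ⟶ Q` be an exact sequence with `A` torsion-free, and with `P` a torsion
object which is a coproduct, such that locally on the subcoproducts `e i : P ⟶ P` the morphism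
`φ : P ⟶ Q` has a generalized inverse `h i` whose associated projection onto the kernel of `φ`
lifts to `B`. Then `A` identifies to the torsion-free quotient of `B`. -/
lemma TorsionPair.isIso_comp_π_of_exists_lift {C : Type u} [Category.{v} C] [Abelian C]
    (t : TorsionPair C) {I K : Type*} [PartialOrder I] [IsDirectedOrder I] [Nonempty I]
    [HasColimitsOfShape I C] [HasExactColimitsOfShape I C] {A B P Q : C}
    (e : I → (P ⟶ P)) (he : ∀ ⦃i j : I⦄, i ≤ j → e i ≫ e j = e i)
    {X : K → C} {inj : ∀ k, X k ⟶ P} (hc : IsColimit (Cofan.mk P inj)) (ℓ : K → I)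
    (h₁ : ∀ k i, ℓ k ≤ i → inj k ≫ e i = inj k) (h₂ : ∀ k i, ¬ ℓ k ≤ i → inj k ≫ e i = 0)
    (hP : t.torsion P) (φ : P ⟶ Q) (h : I → (Q ⟶ P))
    (hφ : ∀ i, e i ≫ φ ≫ h i ≫ φ = e i ≫ φ) (hh : ∀ i, h i ≫ e i = h i)
    (a : A ⟶ B) [Mono a] (δ : B ⟶ P) (w : a ≫ δ = 0) (ex : (ShortComplex.mk a δ w).Exact)
    (w' : δ ≫ φ = 0) (hA : t.torsionFree A)
    (ψ : I → (P ⟶ B)) (hψ : ∀ i, ψ i ≫ δ = e i - e i ≫ φ ≫ h i) :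
    IsIso (a ≫ t.π B) := by
  obtain ⟨D, y, hy, hym, hye, hyl, hy₁, hy₂⟩ := exists_kernel_diagram e he hc ℓ h₁ h₂ φ
  have hyψ (i) : y i ≫ kernel.ι φ ≫ ψ i ≫ δ = y i ≫ kernel.ι φ := by
    have : (y i ≫ kernel.ι φ) ≫ ψ i ≫ δ = y i ≫ kernel.ι φ := by
      rw [hψ, Preadditive.comp_sub, hye, ← Category.assoc, hye, Category.assoc,
        kernel.condition_assoc, zero_comp, comp_zero, sub_zero]
    simpa using this
  -- The morphism `e i - e i ≫ φ ≫ h i` is a projection of `P` onto the part of `kernel φ` inside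
  -- the image of `e i`, so `D.obj i` is a retract of the torsion object `P`.
  have htors (i) : t.torsion (D.obj i) := by
    obtain ⟨ρ, hρ⟩ := hyl (i := i) (e i - e i ≫ φ ≫ h i)
      (by simp only [Preadditive.sub_comp, Category.assoc, he le_rfl, hh])
      (by simp only [Preadditive.sub_comp, Category.assoc, hφ, sub_self])
    have : IsSplitEpi ρ := ⟨⟨y i ≫ kernel.ι φ, by
      rw [← cancel_mono (y i), ← cancel_mono (kernel.ι φ), Category.assoc, Category.assoc, hρ,
        Category.id_comp, Preadditive.comp_sub, hye, ← Category.assoc, hye, Category.assoc,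
        kernel.condition_assoc, zero_comp, comp_zero, sub_zero]⟩⟩
    exact t.torsion_of_epi ρ hP
  -- Two local sections differ by a morphism from the torsion object `D.obj i` to the torsion-free
  -- object `A`, so they agree and glue.
  obtain ⟨s, hs⟩ := hy₂ (fun i ↦ y i ≫ kernel.ι φ ≫ ψ i) (fun i j f ↦ by
    rw [← sub_eq_zero]
    have h0 : (D.map f ≫ y j ≫ kernel.ι φ ≫ ψ j - y i ≫ kernel.ι φ ≫ ψ i) ≫ δ = 0 := by
      simp only [Preadditive.sub_comp, Category.assoc, hyψ]
      rw [reassoc_of% (hy f), sub_self]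
    have : Mono (ShortComplex.mk a δ w).f := ‹_›
    obtain ⟨l, hl⟩ : ∃ l, l ≫ a = _ := ⟨_, ex.lift_f _ h0⟩
    rw [← hl, t.hom_eq_zero l (htors i) hA, zero_comp])
  have hsδ : s ≫ δ = kernel.ι φ := hy₁ _ _ fun i ↦ by
    rw [reassoc_of% (hs i), hyψ]
  have hw : a ≫ kernel.lift φ δ w' = 0 := by
    rw [← cancel_mono (kernel.ι φ), Category.assoc, kernel.lift_ι, w, zero_comp]
  have hker : t.torsion (kernel φ) := by
    rw [t.torsion_iff]
    exact fun F hF f ↦ hy₁ _ _ fun i ↦ by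
      rw [t.hom_eq_zero (y i ≫ f) (htors i) hF, comp_zero]
  refine t.isIso_comp_π a (kernel.lift φ δ w') hw ?_ hA hker s ?_
  · rw [ShortComplex.exact_iff_exact_up_to_refinements] at ex ⊢
    intro Y y hy
    refine ex y ?_
    have := congr_arg (· ≫ kernel.ι φ) hy
    simpa using this
  · rw [← cancel_mono (kernel.ι φ), Category.assoc, kernel.lift_ι, hsδ, Category.id_comp]

/-- The colimit-defining morphism `f` admits a generalized inverse on each of the subcoproducts
`∐_{i ≤ j ≤ k} M_{ij}`. -/
lemma exists_inverse_colimitDefiningMorphism {C I : Type*} [Category* C] [Preadditive C]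
    [PartialOrder I] (M : I ⥤ C)
    {c₂ : Cofan fun p : {p : I × I // p.1 ≤ p.2} ↦ M.obj p.1.1} (hc₂ : IsColimit c₂)
    (c₁ : Cofan M.obj) (hc₁ : IsColimit c₁) :
    ∃ (e : I → (c₂.pt ⟶ c₂.pt)) (h : I → (c₁.pt ⟶ c₂.pt)),
      (∀ p k, p.1.2 ≤ k → c₂.inj p ≫ e k = c₂.inj p) ∧
      (∀ p k, ¬ p.1.2 ≤ k → c₂.inj p ≫ e k = 0) ∧
      (∀ k, e k ≫ colimitDefiningMorphism M hc₂ c₁ ≫ h k ≫ colimitDefiningMorphism M hc₂ c₁ =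
        e k ≫ colimitDefiningMorphism M hc₂ c₁) ∧
      ∀ k, h k ≫ e k = h k := by
  classical
  let e (k : I) : c₂.pt ⟶ c₂.pt :=
    Cofan.IsColimit.desc hc₂ fun p ↦ if p.1.2 ≤ k then c₂.inj p else 0
  -- The summand `M_i` goes identically to the summand of the pair `(i, k)`; this is the homotopy
  -- contracting the system onto its stage `k`.
  let h (k : I) : c₁.pt ⟶ c₂.pt :=
    Cofan.IsColimit.desc hc₁ fun i ↦ if hi : i ≤ k then c₂.inj ⟨(i, k), hi⟩ else 0
  have he (p k) : c₂.inj p ≫ e k = if p.1.2 ≤ k then c₂.inj p else 0 :=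
    Cofan.IsColimit.fac _ _ _
  have hh (i k) : c₁.inj i ≫ h k = if hi : i ≤ k then c₂.inj ⟨(i, k), hi⟩ else 0 :=
    Cofan.IsColimit.fac _ _ _
  refine ⟨e, h, fun p k hk ↦ (he p k).trans (if_pos hk), fun p k hk ↦ (he p k).trans (if_neg hk),
    fun k ↦ Cofan.IsColimit.hom_ext hc₂ _ _ fun p ↦ ?_,
    fun k ↦ Cofan.IsColimit.hom_ext hc₁ _ _ fun i ↦ ?_⟩
  · obtain ⟨⟨i, j⟩, hij⟩ := p
    rw [reassoc_of% (he _ _), reassoc_of% (he _ _)]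
    dsimp only at hij ⊢
    split_ifs with hj
    · rw [inj_colimitDefiningMorphism_assoc, inj_colimitDefiningMorphism]
      dsimp only
      rw [Preadditive.sub_comp, Category.assoc, reassoc_of% (hh _ _), reassoc_of% (hh _ _),
        dif_pos (hij.trans hj), dif_pos hj, inj_colimitDefiningMorphism,
        inj_colimitDefiningMorphism]
      dsimp only
      -- With `λ_i` the inclusion of `M_i` in `c₁.pt`, both `(i, k)` and `(j, k)` contribute the
      -- same term `λ_k ∘ u_ik`, which cancels and leaves `λ_i - λ_j ∘ u_ij`.
      rw [Preadditive.comp_sub, ← M.map_comp_assoc, homOfLE_comp, sub_sub_sub_cancel_right]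
    · rw [zero_comp, zero_comp]
  · rw [reassoc_of% (hh _ _), hh]
    split_ifs with hi
    · rw [he, if_pos le_rfl]
    · rw [zero_comp]

/-! ### Cohomology of the cone of the colimit-defining morphism. -/

namespace DerivedCategory

variable {G : Type u} [Category.{v} G] [Abelian G] [HasDerivedCategory.{w} G]

/-- The morphism induced in homology by a morphism to a shifted object. -/
noncomputable def homologyδ {X Y : DerivedCategory G} (r : X ⟶ Y⟦(1 : ℤ)⟧) (n n' : ℤ)
    (h : n + 1 = n') : (homologyFunctor G n).obj X ⟶ (homologyFunctor G n').obj Y :=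
  (homologyFunctor G 0).shiftMap r n n' (by lia)

lemma map_comp_homologyδ {X X' Y : DerivedCategory G} (x : X' ⟶ X) (r : X ⟶ Y⟦(1 : ℤ)⟧) (n n' : ℤ)
    (h : n + 1 = n') : (homologyFunctor G n).map x ≫ homologyδ r n n' h =
      homologyδ (x ≫ r) n n' h :=
  ((homologyFunctor G 0).shiftMap_comp' x r n n' (by lia)).symm

lemma homologyδ_comp_map {X Y Y' : DerivedCategory G} (r : X ⟶ Y⟦(1 : ℤ)⟧) (y : Y ⟶ Y') (n n' : ℤ)
    (h : n + 1 = n') : homologyδ r n n' h ≫ (homologyFunctor G n').map y =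
      homologyδ (r ≫ y⟦1⟧') n n' h :=
  ((homologyFunctor G 0).shiftMap_comp r y n n' (by lia)).symm

section

variable {X₁ X₂ X₃ : DerivedCategory G} {f : X₁ ⟶ X₂} {g : X₂ ⟶ X₃} {r : X₃ ⟶ X₁⟦(1 : ℤ)⟧}
  (hT : Triangle.mk f g r ∈ distTriang _) (n n' : ℤ) (h : n + 1 = n')

include hT

lemma homology_exact₁ : ∃ w : homologyδ r n n' h ≫ (homologyFunctor G n').map f = 0,
    (ShortComplex.mk _ _ w).Exact :=
  ⟨_, HomologySequence.exact₁ _ hT n n' h⟩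

lemma homology_exact₂ :
    ∃ w : (homologyFunctor G n).map f ≫ (homologyFunctor G n).map g = 0,
      (ShortComplex.mk _ _ w).Exact :=
  ⟨_, HomologySequence.exact₂ _ hT n⟩

lemma homology_exact₃ : ∃ w : (homologyFunctor G n).map g ≫ homologyδ r n n' h = 0,
    (ShortComplex.mk _ _ w).Exact :=
  ⟨_, HomologySequence.exact₃ _ hT n n' h⟩

/-- As `x ≫ f = 0`, the shift of `x` factors through `r` in the derived category; in cohomology this
gives `ψ`. Vanishing of `x ≫ f` on cohomology alone would not suffice. -/
lemma exists_comp_homologyδ_eq {Y : DerivedCategory G} (x : Y ⟶ X₁) (hx : x ≫ f = 0) :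
    ∃ ψ : (homologyFunctor G n').obj Y ⟶ (homologyFunctor G n).obj X₃,
      ψ ≫ homologyδ r n n' h = (homologyFunctor G n').map x := by
  obtain ⟨l, hl⟩ : ∃ l : Y⟦(1 : ℤ)⟧ ⟶ X₃, x⟦(1 : ℤ)⟧' = l ≫ r :=
    Triangle.coyoneda_exact₁ _ hT (x⟦(1 : ℤ)⟧')
      ((Functor.map_comp _ _ _).symm.trans ((congr_arg _ hx).trans (Functor.map_zero _ _ _)))
  have hY : homologyδ (𝟙 (Y⟦(1 : ℤ)⟧)) n n' h =
      ((homologyFunctor G 0).shiftIso 1 n n' (by lia)).hom.app Y :=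
    (congr_arg (· ≫ _) (CategoryTheory.Functor.map_id _ _)).trans (Category.id_comp _)
  have : IsIso (homologyδ (𝟙 (Y⟦(1 : ℤ)⟧)) n n' h) := by
    rw [hY]
    exact NatIso.hom_app_isIso ((homologyFunctor G 0).shiftIso 1 n n' (by lia)) Y
  refine ⟨inv (homologyδ (𝟙 (Y⟦(1 : ℤ)⟧)) n n' h) ≫ (homologyFunctor G n).map l, ?_⟩
  rw [Category.assoc, map_comp_homologyδ, ← hl, IsIso.inv_comp_eq, homologyδ_comp_map,
    Category.id_comp]

end

section

variable [IsGrothendieckAbelian.{v} G] {I : Type v} [PartialOrder I] (N : I ⥤ DerivedCategory G)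
  {c₂ : Cofan fun p : {p : I × I // p.1 ≤ p.2} ↦ N.obj p.1.1} (hc₂ : IsColimit c₂)
  {c₁ : Cofan N.obj} (hc₁ : IsColimit c₁) {Z : DerivedCategory G} {q : c₁.pt ⟶ Z}
  {r : Z ⟶ c₂.pt⟦(1 : ℤ)⟧}
  (hT : Triangle.mk (colimitDefiningMorphism N hc₂ c₁) q r ∈ distTriang (DerivedCategory G))
  (n : ℤ) (c : Cocone (N ⋙ homologyFunctor G n)) (hc : IsColimit c)
  (d : c.pt ⟶ (homologyFunctor G n).obj Z)
  (hd : ∀ i, c.ι.app i ≫ d = (homologyFunctor G n).map (c₁.inj i ≫ q))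

include hc₁ hT hc hd in
-- Since `Hⁿ` preserves coproducts, `c.pt` is the cokernel of `Hⁿ` of the colimit-defining morphism;
-- the long exact sequence embeds this cokernel in `Hⁿ(Z)`.
lemma exists_factor_homology_cone :
    ∃ p : (homologyFunctor G n).obj c₁.pt ⟶ c.pt, Epi p ∧ p ≫ d = (homologyFunctor G n).map q ∧
      Mono d := by
  have hc₁' := (homologyFunctor G n).isColimitMapCofan hc₁
  have hc₂' := (homologyFunctor G n).isColimitMapCofan hc₂
  have hφ := map_colimitDefiningMorphism N hc₂ c₁ (homologyFunctor G n) hc₂'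
  obtain ⟨w, ex⟩ := homology_exact₂ hT n
  have ex' := (ShortComplex.exact_iff_mono_cokernel_desc _).1 ex
  let φ := (homologyFunctor G n).map (colimitDefiningMorphism N hc₂ c₁)
  have w' : colimitDefiningMorphism (N ⋙ homologyFunctor G n) hc₂'
      ((homologyFunctor G n).mapCofan c₁) ≫ cokernel.π φ = 0 := by
    rw [← hφ]; exact cokernel.condition φ
  have hco : IsColimit (CokernelCofork.ofπ (cokernel.π φ) w') :=
    CokernelCofork.IsColimit.ofπ' _ _ fun {A} k hk ↦
      ⟨cokernel.desc φ k (by rw [← hk, ← hφ]), cokernel.π_desc _ _ _⟩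
  have hcc := isColimitColimitDefiningCocone (N ⋙ homologyFunctor G n) hc₂'
    ((homologyFunctor G n).mapCofan c₁) hc₁' (cokernel.π φ) w' hco
  obtain ⟨e, he⟩ : ∃ e : cokernel φ ≅ c.pt, ∀ i,
      (homologyFunctor G n).map (c₁.inj i) ≫ cokernel.π φ ≫ e.hom = c.ι.app i :=
    ⟨hcc.coconePointUniqueUpToIso hc, fun i ↦ (Category.assoc _ _ _).symm.trans
      (hcc.comp_coconePointUniqueUpToIso_hom hc i)⟩
  have hp : (cokernel.π φ ≫ e.hom) ≫ d = (homologyFunctor G n).map q := by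
    refine Cofan.IsColimit.hom_ext hc₁' _ _ fun i ↦ ?_
    have : (homologyFunctor G n).map (c₁.inj i) ≫ (cokernel.π φ ≫ e.hom) ≫ d =
        (homologyFunctor G n).map (c₁.inj i) ≫ (homologyFunctor G n).map q := by
      rw [Category.assoc, ← Functor.map_comp, ← hd, ← he]
      simp only [Category.assoc]
    exact this
  have hm : e.hom ≫ d = cokernel.desc φ _ w := by
    rw [← cancel_epi (cokernel.π φ), cokernel.π_desc, ← Category.assoc, hp]
  have : d = e.inv ≫ cokernel.desc φ _ w := by rw [← hm, e.inv_hom_id_assoc]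
  refine ⟨cokernel.π φ ≫ e.hom, epi_comp _ _, hp, ?_⟩
  rw [this]
  have : Mono (cokernel.desc φ _ w) := ex'
  exact mono_comp _ _

include hc₁ hT hc hd in
lemma exact_homology_cone (n' : ℤ) (h : n + 1 = n') :
    ∃ w : d ≫ homologyδ r n n' h = 0, (ShortComplex.mk _ _ w).Exact := by
  obtain ⟨p, hp, hpd, -⟩ := exists_factor_homology_cone N hc₂ hc₁ hT n c hc d hd
  obtain ⟨w₀, ex⟩ := homology_exact₃ hT n n' h
  have w : d ≫ homologyδ r n n' h = 0 := by
    rw [← cancel_epi p, ← Category.assoc, hpd, w₀, comp_zero]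
  refine ⟨w, ?_⟩
  let S : ShortComplex.mk _ _ w₀ ⟶ ShortComplex.mk _ _ w :=
    { τ₁ := p, τ₂ := 𝟙 _, τ₃ := 𝟙 _,
      comm₁₂ := hpd.trans (Category.comp_id _).symm
      comm₂₃ := (Category.id_comp _).trans (Category.comp_id _).symm }
  have : Epi S.τ₁ := hp
  have : IsIso S.τ₂ := inferInstanceAs (IsIso (𝟙 _))
  have : Mono S.τ₃ := inferInstanceAs (Mono (𝟙 _))
  exact (ShortComplex.exact_iff_of_epi_of_isIso_of_mono S).1 ex

include hc₁ hT hc hd in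
lemma isIso_homology_cone_of_isZero (n' : ℤ) (h : n + 1 = n')
    (h₀ : IsZero ((homologyFunctor G n').obj c₂.pt)) : IsIso d := by
  obtain ⟨p, hp, hpd, hm⟩ := exists_factor_homology_cone N hc₂ hc₁ hT n c hc d hd
  obtain ⟨w, ex⟩ := exact_homology_cone N hc₂ hc₁ hT n c hc d hd n' h
  have : Epi d := ex.epi_f (h₀.eq_of_tgt _ _)
  exact isIso_of_mono_of_epi d

end

end DerivedCategory

open DerivedCategory in
/-- If the homology objects in degree `0` are torsion, and the colimit of the homology
in degree `-1` is torsion-free, then this colimit identifies to the torsion-free quotient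
of the homology of the cone of the colimit-defining morphism. -/
lemma TorsionPair.isIso_homology_cone_comp_π {G : Type u} [Category.{v} G] [Abelian G]
    [HasDerivedCategory.{w} G] [IsGrothendieckAbelian.{v} G] (t : TorsionPair G)
    {I : Type v} [PartialOrder I] [IsDirectedOrder I] [Nonempty I] (N : I ⥤ DerivedCategory G)
    {c₂ : Cofan fun p : {p : I × I // p.1 ≤ p.2} ↦ N.obj p.1.1} (hc₂ : IsColimit c₂)
    {c₁ : Cofan N.obj} (hc₁ : IsColimit c₁) {Z : DerivedCategory G} {q : c₁.pt ⟶ Z}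
    {r : Z ⟶ c₂.pt⟦(1 : ℤ)⟧}
    (hT : Triangle.mk (colimitDefiningMorphism N hc₂ c₁) q r ∈ distTriang (DerivedCategory G))
    (hN : ∀ i, t.torsion ((homologyFunctor G 0).obj (N.obj i)))
    (c : Cocone (N ⋙ homologyFunctor G (-1))) (hc : IsColimit c) (hcF : t.torsionFree c.pt)
    (d : c.pt ⟶ (homologyFunctor G (-1)).obj Z)
    (hd : ∀ i, c.ι.app i ≫ d = (homologyFunctor G (-1)).map (c₁.inj i ≫ q)) :
    IsIso (d ≫ t.π _) := by
  obtain ⟨-, -, -, hdm⟩ := exists_factor_homology_cone N hc₂ hc₁ hT (-1) c hc d hd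
  obtain ⟨w, ex⟩ := exact_homology_cone N hc₂ hc₁ hT (-1) c hc d hd 0 (by lia)
  obtain ⟨w', -⟩ := homology_exact₁ hT (-1) 0 (by lia)
  obtain ⟨e, h, he₁, he₂, he₃, he₄⟩ := exists_inverse_colimitDefiningMorphism N hc₂ c₁ hc₁
  have he ⦃i j : I⦄ (hij : i ≤ j) : e i ≫ e j = e i := by
    refine Cofan.IsColimit.hom_ext hc₂ _ _ fun p ↦ ?_
    by_cases hp : p.1.2 ≤ i
    · rw [← Category.assoc, he₁ p i hp, he₁ p j (hp.trans hij)]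
    · rw [← Category.assoc, he₂ p i hp, zero_comp]
  -- This difference is killed by the colimit-defining morphism in `D(G)` itself, so on `H⁰` it
  -- lifts to `H⁻¹(Z)`.
  have key (i : I) := exists_comp_homologyδ_eq hT (-1) 0 (by lia)
    (e i - e i ≫ colimitDefiningMorphism N hc₂ c₁ ≫ h i) (by
      rw [Preadditive.sub_comp, Category.assoc, Category.assoc, he₃, sub_self])
  choose ψ hψ using key
  have hc₂' := (homologyFunctor G 0).isColimitMapCofan hc₂
  refine t.isIso_comp_π_of_exists_lift (I := I) (fun i ↦ (homologyFunctor G 0).map (e i))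
    (fun i j hij ↦ by rw [← Functor.map_comp, he hij]) hc₂' (fun p ↦ p.1.2)
    (fun p i hi ↦ by rw [← Functor.map_comp, he₁ p i hi])
    (fun p i hi ↦ by rw [← Functor.map_comp, he₂ p i hi, Functor.map_zero])
    (t.torsion_of_isColimit hc₂' fun p ↦ hN _)
    ((homologyFunctor G 0).map (colimitDefiningMorphism N hc₂ c₁))
    (fun i ↦ (homologyFunctor G 0).map (h i))
    (fun i ↦ by simp only [← Functor.map_comp, he₃])
    (fun i ↦ by rw [← Functor.map_comp, he₄]) d _ w ex w' hcF ψ (fun i ↦ ?_)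
  rw [hψ, Functor.map_sub, Functor.map_comp, Functor.map_comp]

namespace DerivedCategory

variable {G : Type u} [Category.{v} G] [Abelian G] [HasDerivedCategory.{w} G]

lemma exists_colimitDefiningMorphism_distTriang [IsGrothendieckAbelian.{v} G] {I : Type v}
    [PartialOrder I] (N : I ⥤ DerivedCategory G) :
    ∃ (c₂ : Cofan fun p : {p : I × I // p.1 ≤ p.2} ↦ N.obj p.1.1) (hc₂ : IsColimit c₂)
      (c₁ : Cofan N.obj) (_ : IsColimit c₁) (Z : DerivedCategory G) (q : c₁.pt ⟶ Z)
      (r : Z ⟶ c₂.pt⟦(1 : ℤ)⟧),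
      Triangle.mk (colimitDefiningMorphism N hc₂ c₁) q r ∈ distTriang (DerivedCategory G) := by
  have := DerivedCategory.hasColimitsOfShape_discrete G I
  have := DerivedCategory.hasColimitsOfShape_discrete G {p : I × I // p.1 ≤ p.2}
  obtain ⟨Z, q, r, hT⟩ := distinguished_cocone_triangle
    (colimitDefiningMorphism N (coproductIsCoproduct _) (Cofan.mk _ (Limits.Sigma.ι N.obj)))
  exact ⟨_, _, _, coproductIsCoproduct _, Z, q, r, hT⟩

end DerivedCategory

/-! ### Cohomology of direct limits in the Happel-Reiten-Smalø heart. -/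

namespace TorsionPair

variable {G : Type u} [Category.{v} G] [Abelian G] [HasDerivedCategory.{w} G] (t : TorsionPair G)

open DerivedCategory

lemma torsion_homology_of_isLE {X : DerivedCategory G} {n : ℤ} (h : t.hrsTStructure.IsLE X n) :
    t.torsion ((homologyFunctor G n).obj X) := h.le.2

lemma isZero_homology_of_isLE {X : DerivedCategory G} {n : ℤ} (h : t.hrsTStructure.IsLE X n)
    (i : ℤ) (hi : n < i) : IsZero ((homologyFunctor G i).obj X) :=
  have := h.le.1
  X.isZero_of_isLE n i hi

lemma torsionFree_homology_of_isGE {X : DerivedCategory G} {n : ℤ}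
    (h : t.hrsTStructure.IsGE X n) (n' : ℤ) (hn : n' + 1 = n) :
    t.torsionFree ((homologyFunctor G n').obj X) := by
  obtain rfl : n' = n - 1 := by lia
  exact h.ge.2

lemma isZero_homology_of_isGE {X : DerivedCategory G} {n : ℤ} (h : t.hrsTStructure.IsGE X n)
    (i : ℤ) (hi : i + 1 < n) : IsZero ((homologyFunctor G i).obj X) :=
  have := h.ge.1
  X.isZero_of_isGE (n - 1) i (by lia)

lemma torsion_heartHomology (X : t.Heart) : t.torsion ((t.heartHomology 0).obj X) :=
  ((t.heart_iff _).1 X.property).2.1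

lemma torsionFree_heartHomology (X : t.Heart) : t.torsionFree ((t.heartHomology (-1)).obj X) :=
  ((t.heart_iff _).1 X.property).2.2

lemma isZero_heartHomology (X : t.Heart) (n : ℤ) (h₁ : n ≠ -1) (h₀ : n ≠ 0) :
    IsZero ((t.heartHomology n).obj X) :=
  ((t.heart_iff _).1 X.property).1 n h₁ h₀

/-- The homology of the truncation for the Happel-Reiten-Smalø t-structure. -/
lemma homology_of_distTriang {U Z W : DerivedCategory G} {a : U ⟶ Z} {k : Z ⟶ W}
    {r : W ⟶ U⟦(1 : ℤ)⟧} (hT : Triangle.mk a k r ∈ distTriang _)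
    (hU : t.hrsTStructure.IsLE U (-1)) (hW : t.hrsTStructure.IsGE W 0) :
    IsIso ((homologyFunctor G 0).map k) ∧
      ∃ e : t.quotient ((homologyFunctor G (-1)).obj Z) ≅ (homologyFunctor G (-1)).obj W,
        t.π _ ≫ e.hom = (homologyFunctor G (-1)).map k := by
  constructor
  · have h₁ : Epi ((homologyFunctor G 0).map k) :=
      (HomologySequence.epi_homologyMap_mor₂_iff _ hT 0 1).2
        ((t.isZero_homology_of_isLE hU 1 (by lia)).eq_of_tgt _ _)
    have h₂ : Mono ((homologyFunctor G 0).map k) :=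
      (HomologySequence.mono_homologyMap_mor₂_iff _ hT 0).2
        ((t.isZero_homology_of_isLE hU 0 (by lia)).eq_of_src _ _)
    exact isIso_of_mono_of_epi ((homologyFunctor G 0).map k)
  · obtain ⟨w, ex⟩ := homology_exact₂ hT (-1)
    have h₁ : Mono ((homologyFunctor G (-1)).map a) :=
      (HomologySequence.mono_homologyMap_mor₁_iff _ hT (-2) (-1)).2
        ((t.isZero_homology_of_isGE hW (-2) (by lia)).eq_of_src _ _)
    have h₂ : Epi ((homologyFunctor G (-1)).map k) :=
      (HomologySequence.epi_homologyMap_mor₂_iff _ hT (-1) 0).2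
        ((t.isZero_homology_of_isLE hU 0 (by lia)).eq_of_tgt _ _)
    exact t.exists_iso_quotient { exact := ex, mono_f := h₁, epi_g := h₂ }
      (t.torsion_homology_of_isLE hU) (t.torsionFree_homology_of_isGE hW (-1) (by lia))

section

variable {I : Type v} [PartialOrder I] (M : I ⥤ t.Heart)
  {c₂ : Cofan fun p : {p : I × I // p.1 ≤ p.2} ↦ (M ⋙ t.heartι).obj p.1.1} (hc₂ : IsColimit c₂)
  {c₁ : Cofan (M ⋙ t.heartι).obj} (hc₁ : IsColimit c₁) {Z : DerivedCategory G} (q : c₁.pt ⟶ Z)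
  (r : Z ⟶ c₂.pt⟦(1 : ℤ)⟧)
  (hT : Triangle.mk (colimitDefiningMorphism (M ⋙ t.heartι) hc₂ c₁) q r ∈
    distTriang (DerivedCategory G))

include hc₁ hT in
-- The direct limit in the heart is the truncation of `Z`; passing to it leaves `H⁰` unchanged and
-- divides `H⁻¹` by its torsion.
lemma exists_truncation_of_isColimit {c : Cocone M} (hc : IsColimit c) :
    ∃ k : Z ⟶ c.pt.obj, (∀ i, c₁.inj i ≫ q ≫ k = (c.ι.app i).hom) ∧
      IsIso ((homologyFunctor G 0).map k) ∧
      ∃ e : t.quotient ((homologyFunctor G (-1)).obj Z) ≅ (homologyFunctor G (-1)).obj c.pt.obj,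
        t.π _ ≫ e.hom = (homologyFunctor G (-1)).map k := by
  obtain ⟨e, he⟩ := t.hrsTStructure.exists_iso_of_isColimit M hc₂ hc₁ q r hT hc
  have hT' := t.hrsTStructure.triangleLTGE_distinguished 0 Z
  obtain ⟨h₁, e', he'⟩ := t.homology_of_distTriang hT'
    (inferInstanceAs (t.hrsTStructure.IsLE ((t.hrsTStructure.truncLT 0).obj Z) (0 - 1)))
    (inferInstanceAs (t.hrsTStructure.IsGE ((t.hrsTStructure.truncGE 0).obj Z) 0))
  refine ⟨(t.hrsTStructure.truncGEπ 0).app Z ≫ e.hom, he, ?_,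
    e' ≪≫ (homologyFunctor G (-1)).mapIso e, ?_⟩
  · rw [Functor.map_comp]
    exact IsIso.comp_isIso' h₁ (Iso.isIso_hom ((homologyFunctor G 0).mapIso e))
  · rw [Functor.map_comp]
    exact (Category.assoc _ _ _).symm.trans
      (congr_arg (· ≫ (homologyFunctor G (-1)).map e.hom) he')

end

lemma preservesColimit_of_isIso {I : Type*} [Category* I] (M : I ⥤ t.Heart) {n : ℤ}
    {c : Cocone M} (hc : IsColimit c)
    {c' : Cocone (M ⋙ t.heartHomology n)} (hc' : IsColimit c')
    (d : c'.pt ⟶ (t.heartHomology n).obj c.pt)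
    (hd : ∀ i, c'.ι.app i ≫ d = (t.heartHomology n).map (c.ι.app i)) [IsIso d] :
    PreservesColimit M (t.heartHomology n) :=
  preservesColimit_of_preserves_colimit_cocone hc
    (IsColimit.ofIsoColimit hc' (Cocone.ext (asIso d) hd))

lemma preservesColimit_heartHomology_of_ne {I : Type*} [Category* I] (M : I ⥤ t.Heart) (n : ℤ)
    (h₁ : n ≠ -1) (h₀ : n ≠ 0) : PreservesColimit M (t.heartHomology n) where
  preserves _ := ⟨
    { desc _ := 0
      fac _ _ := (t.isZero_heartHomology _ n h₁ h₀).eq_of_src _ _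
      uniq _ _ _ := (t.isZero_heartHomology _ n h₁ h₀).eq_of_src _ _ }⟩

section

variable [IsGrothendieckAbelian.{v} G] {I : Type v} [PartialOrder I] (M : I ⥤ t.Heart)

instance hasColimit_heart : HasColimit M := by
  have := DerivedCategory.hasColimitsOfShape_discrete G I
  have := DerivedCategory.hasColimitsOfShape_discrete G {p : I × I // p.1 ≤ p.2}
  exact t.hrsTStructure.hasColimit_heart M

/-- The obstruction to `lim H⁰(M_i) ≅ H⁰(Z)` lies in `H¹(∐ M_ij)`, which vanishes; truncation does
not change `H⁰`. -/
instance preservesColimit_heartHomology_zero : PreservesColimit M (t.heartHomology 0) := by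
  obtain ⟨c₂, hc₂, c₁, hc₁, Z, q, r, hT⟩ :=
    exists_colimitDefiningMorphism_distTriang (M ⋙ t.heartι)
  obtain ⟨k, hk, hk₀, -⟩ :=
    t.exists_truncation_of_isColimit M hc₂ hc₁ q r hT (colimit.isColimit M)
  let c := colimit.cocone ((M ⋙ t.heartι) ⋙ homologyFunctor G 0)
  let c' := (homologyFunctor G 0).mapCocone (colimitDefiningCocone (M ⋙ t.heartι) hc₂ c₁ q
    (comp_distTriang_mor_zero₁₂ _ hT))
  have hd (i) : c.ι.app i ≫ colimit.desc _ c' = (homologyFunctor G 0).map (c₁.inj i ≫ q) :=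
    colimit.ι_desc c' i
  have : IsIso (colimit.desc _ c') := isIso_homology_cone_of_isZero (M ⋙ t.heartι) hc₂ hc₁ hT 0
    c (colimit.isColimit _) (colimit.desc _ c') hd 1 (by lia) (by
      rw [IsZero.iff_id_eq_zero]
      refine Cofan.IsColimit.hom_ext ((homologyFunctor G 1).isColimitMapCofan hc₂) _ _ fun p ↦ ?_
      exact (t.isZero_heartHomology (M.obj p.1.1) 1 (by lia) (by lia)).eq_of_src _ _)
  have : IsIso (colimit.desc _ c' ≫ (homologyFunctor G 0).map k) := IsIso.comp_isIso' this hk₀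
  refine t.preservesColimit_of_isIso M (colimit.isColimit M)
    (c' := c) (colimit.isColimit _)
    (colimit.desc _ c' ≫ (homologyFunctor G 0).map k) (fun i ↦ ?_)
  refine (Category.assoc _ _ _).symm.trans ?_
  refine (congr_arg (· ≫ (homologyFunctor G 0).map k) (hd i)).trans ?_
  rw [← Functor.map_comp, Category.assoc, hk]
  rfl

variable [IsDirectedOrder I] [Nonempty I]

lemma isIso_desc_comp_π
    {c₂ : Cofan fun p : {p : I × I // p.1 ≤ p.2} ↦ (M ⋙ t.heartι).obj p.1.1} (hc₂ : IsColimit c₂)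
    {c₁ : Cofan (M ⋙ t.heartι).obj} (hc₁ : IsColimit c₁) {Z : DerivedCategory G} (q : c₁.pt ⟶ Z)
    (r : Z ⟶ c₂.pt⟦(1 : ℤ)⟧)
    (hT : Triangle.mk (colimitDefiningMorphism (M ⋙ t.heartι) hc₂ c₁) q r ∈
      distTriang (DerivedCategory G)) (hM : t.torsionFree (colimit (M ⋙ t.heartHomology (-1)))) :
    IsIso (colimit.desc ((M ⋙ t.heartι) ⋙ homologyFunctor G (-1))
      ((homologyFunctor G (-1)).mapCocone
        (colimitDefiningCocone (M ⋙ t.heartι) hc₂ c₁ q (comp_distTriang_mor_zero₁₂ _ hT))) ≫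
      t.π ((homologyFunctor G (-1)).obj Z)) :=
  t.isIso_homology_cone_comp_π (M ⋙ t.heartι) hc₂ hc₁ hT (fun _ ↦ t.torsion_heartHomology _)
    (colimit.cocone _) (colimit.isColimit _) hM _ (colimit.ι_desc _)

/-- Both sides identify with `H⁻¹(Z)/t(H⁻¹(Z))`. The hypothesis concerns this one system only, so
the result can be applied before closure of `ℱ` is known. -/
lemma preservesColimit_heartHomology_neg_one
    (hM : t.torsionFree (colimit (M ⋙ t.heartHomology (-1)))) :
    PreservesColimit M (t.heartHomology (-1)) := by
  obtain ⟨c₂, hc₂, c₁, hc₁, Z, q, r, hT⟩ :=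
    exists_colimitDefiningMorphism_distTriang (M ⋙ t.heartι)
  obtain ⟨k, hk, -, e, he⟩ :=
    t.exists_truncation_of_isColimit M hc₂ hc₁ q r hT (colimit.isColimit M)
  have h := t.isIso_desc_comp_π M hc₂ hc₁ q r hT hM
  let c := colimit.cocone ((M ⋙ t.heartι) ⋙ homologyFunctor G (-1))
  let c' := (homologyFunctor G (-1)).mapCocone (colimitDefiningCocone (M ⋙ t.heartι) hc₂ c₁ q
    (comp_distTriang_mor_zero₁₂ _ hT))
  have hd (i) : c.ι.app i ≫ colimit.desc _ c' = (homologyFunctor G (-1)).map (c₁.inj i ≫ q) :=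
    colimit.ι_desc c' i
  have hd' : (colimit.desc _ c' ≫ t.π _) ≫ e.hom =
      colimit.desc _ c' ≫ (homologyFunctor G (-1)).map k :=
    (Category.assoc _ _ _).trans (congr_arg (colimit.desc _ c' ≫ ·) he)
  have : IsIso (colimit.desc _ c' ≫ (homologyFunctor G (-1)).map k) := by
    rw [← hd']
    exact IsIso.comp_isIso' h (Iso.isIso_hom e)
  refine t.preservesColimit_of_isIso M (colimit.isColimit M)
    (c' := c) (colimit.isColimit _)
    (colimit.desc _ c' ≫ (homologyFunctor G (-1)).map k) (fun i ↦ ?_)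
  refine (Category.assoc _ _ _).symm.trans ?_
  refine (congr_arg (· ≫ (homologyFunctor G (-1)).map k) (hd i)).trans ?_
  rw [← Functor.map_comp, Category.assoc, hk]
  rfl

end

end TorsionPair

/-! ### Exactness of direct limits in the heart. -/

namespace CategoryTheory.Triangulated.TStructure

variable {C : Type*} [Category* C] [Preadditive C] [HasZeroObject C] [HasShift C ℤ]
  [∀ n : ℤ, (shiftFunctor C n).Additive] [Pretriangulated C]
  (t : TStructure C)

/-- The connecting morphisms of the distinguished triangles associated with short exact
sequences in the heart are natural. -/
lemma connecting_naturality {S S' : ShortComplex t.heart.FullSubcategory} (φ : S ⟶ S')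
    (hS : S.ShortExact)
    {δ : S.X₃.obj ⟶ S.X₁.obj⟦(1 : ℤ)⟧} {δ' : S'.X₃.obj ⟶ S'.X₁.obj⟦(1 : ℤ)⟧}
    (hT : Triangle.mk (t.heart.ι.map S.f) (t.heart.ι.map S.g) δ ∈ distTriang C)
    (hT' : Triangle.mk (t.heart.ι.map S'.f) (t.heart.ι.map S'.g) δ' ∈ distTriang C) :
    δ ≫ (t.heart.ι.map φ.τ₁)⟦(1 : ℤ)⟧' = t.heart.ι.map φ.τ₃ ≫ δ' := by
  have := hS.epi_g
  obtain ⟨c, hc₁, hc₂⟩ := complete_distinguished_triangle_morphism _ _ hT hT'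
    (t.heart.ι.map φ.τ₁) (t.heart.ι.map φ.τ₂)
    ((t.heart.ι.map_comp _ _).symm.trans
      ((congr_arg t.heart.ι.map φ.comm₁₂.symm).trans (t.heart.ι.map_comp _ _)))
  obtain ⟨c, rfl⟩ := t.heart.ι.map_surjective c
  have : c = φ.τ₃ := by
    rw [← cancel_epi S.g]
    apply t.heart.ι.map_injective
    exact (t.heart.ι.map_comp _ _).trans (hc₁.trans ((t.heart.ι.map_comp _ _).symm.trans
      (congr_arg t.heart.ι.map φ.comm₂₃)))
  subst this
  exact hc₂

end CategoryTheory.Triangulated.TStructure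

namespace TorsionPair

variable {G : Type u} [Category.{v} G] [Abelian G] [HasDerivedCategory.{w} G] (t : TorsionPair G)

open DerivedCategory

attribute [local instance] TStructure.abelianHeart

lemma mono_heartHomology_neg_one_of_distTriang {X₁ X₂ X₃ : t.Heart} {f : X₁ ⟶ X₂} {g : X₂ ⟶ X₃}
    {δ : X₃.obj ⟶ X₁.obj⟦(1 : ℤ)⟧}
    (hT : Triangle.mk (t.heartι.map f) (t.heartι.map g) δ ∈ distTriang (DerivedCategory G)) :
    Mono ((t.heartHomology (-1)).map f) :=
  (HomologySequence.mono_homologyMap_mor₁_iff _ hT (-2) (-1)).2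
    ((t.isZero_heartHomology X₃ (-2) (by lia) (by lia)).eq_of_src _ _)

lemma epi_heartHomology_zero_of_distTriang {X₁ X₂ X₃ : t.Heart} {f : X₁ ⟶ X₂} {g : X₂ ⟶ X₃}
    {δ : X₃.obj ⟶ X₁.obj⟦(1 : ℤ)⟧}
    (hT : Triangle.mk (t.heartι.map f) (t.heartι.map g) δ ∈ distTriang (DerivedCategory G)) :
    Epi ((t.heartHomology 0).map g) :=
  (HomologySequence.epi_homologyMap_mor₂_iff _ hT 0 1).2
    ((t.isZero_heartHomology X₁ 1 (by lia) (by lia)).eq_of_tgt _ _)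

instance additive_heartHomology (n : ℤ) : (t.heartHomology n).Additive :=
  inferInstanceAs (t.heartι ⋙ homologyFunctor G n).Additive

/-- `H⁻²` vanishes on the heart, so the long exact sequence starts at `H⁻¹`. -/
instance preservesFiniteLimits_heartHomology_neg_one :
    PreservesFiniteLimits (t.heartHomology (-1)) := by
  refine ((Functor.preservesFiniteLimits_tfae _).out 0 3).1 fun S hS ↦ ?_
  obtain ⟨δ, hT⟩ := t.hrsTStructure.exists_distTriang_of_shortExact hS
  obtain ⟨_, h⟩ := homology_exact₂ hT (-1)
  exact ⟨h, t.mono_heartHomology_neg_one_of_distTriang hT⟩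

instance preservesEpimorphisms_heartHomology_zero :
    (t.heartHomology 0).PreservesEpimorphisms where
  preserves {X Y} f _ := by
    have hS : (ShortComplex.mk (kernel.ι f) f (kernel.condition f)).ShortExact :=
      { exact := ShortComplex.exact_kernel f }
    obtain ⟨δ, hT⟩ := t.hrsTStructure.exists_distTriang_of_shortExact hS
    exact t.epi_heartHomology_zero_of_distTriang hT

lemma isIso_of_isIso_heartHomology {X Y : t.Heart} (f : X ⟶ Y)
    (h₁ : IsIso ((t.heartHomology (-1)).map f)) (h₀ : IsIso ((t.heartHomology 0).map f)) :
    IsIso f := by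
  have : IsIso (t.heartι.map f) := by
    rw [DerivedCategory.isIso_iff]
    intro n
    by_cases hn₁ : n = -1
    · subst hn₁; exact h₁
    by_cases hn₀ : n = 0
    · subst hn₀; exact h₀
    exact ⟨0, (t.isZero_heartHomology X n hn₁ hn₀).eq_of_src _ _,
      (t.isZero_heartHomology Y n hn₁ hn₀).eq_of_src _ _⟩
  exact isIso_of_reflects_iso f t.heartι

end TorsionPair

namespace TorsionPair

variable {G : Type u} [Category.{v} G] [Abelian G] [HasDerivedCategory.{w} G] (t : TorsionPair G)
  [IsGrothendieckAbelian.{v} G] {I : Type v} [PartialOrder I] [IsDirectedOrder I] [Nonempty I]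

open DerivedCategory

attribute [local instance] TStructure.abelianHeart

section

variable {M N P : I ⥤ t.Heart} (α : M ⟶ N) (β : N ⟶ P) (hαβ : ∀ i, α.app i ≫ β.app i = 0)
  (hS : ∀ i, (ShortComplex.mk _ _ (hαβ i)).ShortExact) {cM : Cocone M} {cN : Cocone N}
  {cP : Cocone P} (hcM : IsColimit cM) (hcN : IsColimit cN) (hcP : IsColimit cP)
  (m : cM.pt ⟶ cN.pt) (p : cN.pt ⟶ cP.pt) (hm : ∀ i, cM.ι.app i ≫ m = α.app i ≫ cN.ι.app i)
  (hp : ∀ i, cN.ι.app i ≫ p = β.app i ≫ cP.ι.app i) (hmp : m ≫ p = 0)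

include hαβ hS hcM hcN hcP hm hp in
-- Both `H⁻¹(lim M)` and `H⁻¹(kernel p)` are kernels of `H⁻¹(p)`: the first by exactness of direct
-- limits in `G` and preservation by `H⁻¹`, the second by left exactness of `H⁻¹`.
lemma isIso_heartHomology_neg_one_lift [PreservesColimitsOfShape I (t.heartHomology (-1))] :
    IsIso ((t.heartHomology (-1)).map (kernel.lift p m hmp)) := by
  have hFm : (t.heartHomology (-1)).map (kernel.lift p m hmp) ≫
      (t.heartHomology (-1)).map (kernel.ι p) = (t.heartHomology (-1)).map m := by
    rw [← Functor.map_comp, kernel.lift_ι]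
  have hFm' (i) : (t.heartHomology (-1)).map (cM.ι.app i) ≫ (t.heartHomology (-1)).map m =
      (t.heartHomology (-1)).map (α.app i) ≫ (t.heartHomology (-1)).map (cN.ι.app i) := by
    rw [← Functor.map_comp, hm, Functor.map_comp]
  have hFp' (i) : (t.heartHomology (-1)).map (cN.ι.app i) ≫ (t.heartHomology (-1)).map p =
      (t.heartHomology (-1)).map (β.app i) ≫ (t.heartHomology (-1)).map (cP.ι.app i) := by
    rw [← Functor.map_comp, hp, Functor.map_comp]
  have h₁ : Mono ((t.heartHomology (-1)).map m) :=
    mono_of_isColimit (Functor.whiskerRight α (t.heartHomology (-1)))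
      (fun i ↦ by
        have := (hS i).mono_f
        exact inferInstanceAs (Mono ((t.heartHomology (-1)).map (ShortComplex.mk _ _ (hαβ i)).f)))
      (isColimitOfPreserves (t.heartHomology (-1)) hcM)
      (isColimitOfPreserves (t.heartHomology (-1)) hcN) _
      hFm'
  have w : (t.heartHomology (-1)).map m ≫ (t.heartHomology (-1)).map p = 0 := by
    rw [← Functor.map_comp, hmp, Functor.map_zero]
  have hw (i) : (t.heartHomology (-1)).map (α.app i) ≫
      (t.heartHomology (-1)).map (β.app i) = 0 := by
    rw [← Functor.map_comp, hαβ, Functor.map_zero]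
  have h₂ : (ShortComplex.mk _ _ w).Exact :=
    exact_of_isColimit (Functor.whiskerRight α (t.heartHomology (-1)))
      (Functor.whiskerRight β (t.heartHomology (-1))) hw
      (fun i ↦ (hS i).exact.map_of_mono_of_preservesKernel (t.heartHomology (-1))
        (hS i).mono_f inferInstance)
      (isColimitOfPreserves (t.heartHomology (-1)) hcM)
      (isColimitOfPreserves (t.heartHomology (-1)) hcN)
      (isColimitOfPreserves (t.heartHomology (-1)) hcP) _ _
      hFm'
      hFp' w
  have h₃ : Mono ((t.heartHomology (-1)).map (kernel.lift p m hmp)) := by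
    rw [← hFm] at h₁
    exact mono_of_mono _ ((t.heartHomology (-1)).map (kernel.ι p))
  have h₄ : Epi ((t.heartHomology (-1)).map (kernel.lift p m hmp)) := by
    rw [epi_iff_surjective_up_to_refinements]
    intro A y
    obtain ⟨A', π, hπ, x, hx⟩ := h₂.exact_up_to_refinements
      (y ≫ (t.heartHomology (-1)).map (kernel.ι p))
      (by rw [Category.assoc, ← Functor.map_comp, kernel.condition, Functor.map_zero, comp_zero])
    refine ⟨A', π, hπ, x, ?_⟩
    rw [← cancel_mono ((t.heartHomology (-1)).map (kernel.ι p)), Category.assoc, Category.assoc,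
      hFm]
    exact hx
  exact isIso_of_mono_of_epi _

include hS hcM hcN hcP hm hp in
-- The connecting morphisms `H⁻¹(P_i) ⟶ H⁰(M_i)` pass to the limit as `D`, and the limit sequence is
-- compared with the long exact sequence of `kernel p`; the rest is a diagram chase.
lemma mono_heartHomology_zero_lift [PreservesColimitsOfShape I (t.heartHomology (-1))] [Epi p] :
    Mono ((t.heartHomology 0).map (kernel.lift p m hmp)) := by
  have hL : (ShortComplex.mk (kernel.ι p) p (kernel.condition p)).ShortExact :=
    { exact := ShortComplex.exact_kernel p }
  obtain ⟨δ', hT'⟩ := t.hrsTStructure.exists_distTriang_of_shortExact hL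
  choose δ hT using fun i ↦ t.hrsTStructure.exists_distTriang_of_shortExact (hS i)
  have hδ {i j : I} (f : i ⟶ j) :
      δ i ≫ (t.heartι.map (M.map f))⟦(1 : ℤ)⟧' = t.heartι.map (P.map f) ≫ δ j :=
    t.hrsTStructure.connecting_naturality
      (S := .mk _ _ (hαβ i)) (S' := .mk _ _ (hαβ j))
      { τ₁ := M.map f, τ₂ := N.map f, τ₃ := P.map f } (hS i) (hT i) (hT j)
  have hδ' (i : I) : δ i ≫ (t.heartι.map (cM.ι.app i ≫ kernel.lift p m hmp))⟦(1 : ℤ)⟧' =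
      t.heartι.map (cP.ι.app i) ≫ δ' :=
    t.hrsTStructure.connecting_naturality
      (S := .mk _ _ (hαβ i)) (S' := .mk _ _ (kernel.condition p))
      { τ₁ := cM.ι.app i ≫ kernel.lift p m hmp, τ₂ := cN.ι.app i, τ₃ := cP.ι.app i
        comm₁₂ := by
          dsimp
          rw [Category.assoc, kernel.lift_ι]
          exact hm i
        comm₂₃ := hp i } (hS i) (hT i) hT'
  let Δ : P ⋙ t.heartHomology (-1) ⟶ M ⋙ t.heartHomology 0 :=
    { app i := homologyδ (δ i) (-1) 0 (by lia)
      naturality i j f :=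
        (map_comp_homologyδ (t.heartι.map (P.map f)) (δ j) (-1) 0 (by lia)).trans
          ((congr_arg (homologyδ · (-1) 0 (by lia)) (hδ f).symm).trans
            (homologyδ_comp_map (δ i) (t.heartι.map (M.map f)) (-1) 0 (by lia)).symm) }
  have hP := isColimitOfPreserves (t.heartHomology (-1)) hcP
  have hN := isColimitOfPreserves (t.heartHomology (-1)) hcN
  have hM₀ := isColimitOfPreserves (t.heartHomology 0) hcM
  have hN₀ := isColimitOfPreserves (t.heartHomology 0) hcN
  obtain ⟨D, hD⟩ : ∃ D : (t.heartHomology (-1)).obj cP.pt ⟶ (t.heartHomology 0).obj cM.pt,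
      ∀ i, (t.heartHomology (-1)).map (cP.ι.app i) ≫ D =
        Δ.app i ≫ (t.heartHomology 0).map (cM.ι.app i) :=
    ⟨hP.map ((t.heartHomology 0).mapCocone cM) Δ, hP.ι_map _ Δ⟩
  have hDL : D ≫ (t.heartHomology 0).map (kernel.lift p m hmp) = homologyδ δ' (-1) 0 (by lia) := by
    refine hP.hom_ext fun i ↦ ?_
    have h₁ : homologyδ (δ i) (-1) 0 (by lia) ≫ (t.heartHomology 0).map (cM.ι.app i) ≫
        (t.heartHomology 0).map (kernel.lift p m hmp) =
          (t.heartHomology (-1)).map (cP.ι.app i) ≫ homologyδ δ' (-1) 0 (by lia) := by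
      rw [← Functor.map_comp]
      refine (homologyδ_comp_map (δ i) _ (-1) 0 (by lia)).trans ?_
      refine (congr_arg (homologyδ · (-1) 0 (by lia)) (hδ' i)).trans ?_
      exact (map_comp_homologyδ (t.heartι.map (cP.ι.app i)) δ' (-1) 0 (by lia)).symm
    refine Eq.trans ?_ h₁
    refine (Category.assoc _ _ _).symm.trans ?_
    exact (congr_arg (· ≫ (t.heartHomology 0).map (kernel.lift p m hmp)) (hD i)).trans
      (Category.assoc _ _ _)
  have hFp (i) : (t.heartHomology (-1)).map (cN.ι.app i) ≫ (t.heartHomology (-1)).map p =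
      (t.heartHomology (-1)).map (β.app i) ≫ (t.heartHomology (-1)).map (cP.ι.app i) := by
    rw [← Functor.map_comp, hp, Functor.map_comp]
  have hFm (i) : (t.heartHomology 0).map (cM.ι.app i) ≫ (t.heartHomology 0).map m =
      (t.heartHomology 0).map (α.app i) ≫ (t.heartHomology 0).map (cN.ι.app i) := by
    rw [← Functor.map_comp, hm, Functor.map_comp]
  have hw₁ (i) : (t.heartHomology (-1)).map (β.app i) ≫ Δ.app i = 0 :=
    (homology_exact₃ (hT i) (-1) 0 (by lia)).choose
  have hw₂ (i) : Δ.app i ≫ (t.heartHomology 0).map (α.app i) = 0 :=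
    (homology_exact₁ (hT i) (-1) 0 (by lia)).choose
  have w₁ : (t.heartHomology (-1)).map p ≫ D = 0 := by
    refine hN.hom_ext fun i ↦ ?_
    have : (t.heartHomology (-1)).map (cN.ι.app i) ≫ (t.heartHomology (-1)).map p ≫ D = 0 := by
      rw [← Category.assoc, hFp, Category.assoc, hD, ← Category.assoc, hw₁, zero_comp]
    exact this.trans comp_zero.symm
  have w₂ : D ≫ (t.heartHomology 0).map m = 0 := by
    refine hP.hom_ext fun i ↦ ?_
    have : (t.heartHomology (-1)).map (cP.ι.app i) ≫ D ≫ (t.heartHomology 0).map m = 0 := by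
      rw [← Category.assoc, hD, Category.assoc, hFm, ← Category.assoc, hw₂, zero_comp]
    exact this.trans comp_zero.symm
  have ex₁ : (ShortComplex.mk _ _ w₁).Exact :=
    exact_of_isColimit (Functor.whiskerRight β (t.heartHomology (-1))) Δ hw₁
      (fun i ↦ (homology_exact₃ (hT i) (-1) 0 (by lia)).choose_spec) hN hP hM₀ _ _ hFp hD w₁
  have ex₂ : (ShortComplex.mk _ _ w₂).Exact :=
    exact_of_isColimit Δ (Functor.whiskerRight α (t.heartHomology 0)) hw₂
      (fun i ↦ (homology_exact₁ (hT i) (-1) 0 (by lia)).choose_spec) hP hM₀ hN₀ _ _ hD hFm w₂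
  obtain ⟨_, ex₃⟩ := homology_exact₃ hT' (-1) 0 (by lia)
  -- If `x` dies in `H⁰(kernel p)`, it dies in `H⁰(lim N)`, so locally `x = y ≫ D`. Then `y` is
  -- killed by the connecting morphism of `kernel p`, so locally it comes from `H⁻¹(lim N)`, and `D`
  -- kills it.
  rw [Preadditive.mono_iff_cancel_zero]
  intro A x hx
  have hx₀ : x ≫ (t.heartHomology 0).map m = 0 := by
    rw [← kernel.lift_ι p m hmp, Functor.map_comp, ← Category.assoc, hx, zero_comp]
  obtain ⟨A', π, hπ, y, hy⟩ := ex₂.exact_up_to_refinements x hx₀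
  have hy₀ : y ≫ homologyδ δ' (-1) 0 (by lia) = 0 := by
    rw [← hDL]
    have h : π ≫ x = y ≫ D := hy
    rw [← reassoc_of% h, hx, comp_zero]
  obtain ⟨A'', π', hπ', z, hz⟩ := ex₃.exact_up_to_refinements y hy₀
  have hz' : π' ≫ y = z ≫ (t.heartHomology (-1)).map p := hz
  have hy' : π ≫ x = y ≫ D := hy
  rw [← cancel_epi π, ← cancel_epi π', hy', ← Category.assoc, hz', Category.assoc, w₁, comp_zero,
    comp_zero, comp_zero]

include hαβ hS hcM hcN hcP hm hp in
-- The comparison `lim M ⟶ kernel p` is epi by exactness in the middle, hence epi on `H⁰`. With the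
-- two preceding lemmas it is an isomorphism on `H⁻¹` and `H⁰`, so `m` is a kernel up to
-- isomorphism.
lemma mono_of_isColimit_heart [PreservesColimitsOfShape I (t.heartHomology (-1))]
    (h : (ShortComplex.mk _ _ hmp).Exact) [Epi p] : Mono m := by
  have h₁ := t.isIso_heartHomology_neg_one_lift α β hαβ hS hcM hcN hcP m p hm hp hmp
  have h₂ := t.mono_heartHomology_zero_lift α β hαβ hS hcM hcN hcP m p hm hp hmp
  have : Epi (kernel.lift p m hmp) := (ShortComplex.exact_iff_epi_kernel_lift _).1 h
  have h₃ : Epi ((t.heartHomology 0).map (kernel.lift p m hmp)) := inferInstance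
  have := t.isIso_of_isIso_heartHomology (kernel.lift p m hmp) h₁ (isIso_of_mono_of_epi _)
  rw [← kernel.lift_ι p m hmp]
  exact mono_comp _ _

end

lemma hasExactColimitsOfShape_heart [HasColimitsOfShape I t.Heart]
    [PreservesColimitsOfShape I (t.heartHomology (-1))] :
    HasExactColimitsOfShape I t.Heart where
  preservesFiniteLimits := by
    refine ((Functor.preservesFiniteLimits_tfae _).out 0 3).1 fun S hS ↦ ?_
    have := hS.mono_f
    have := hS.epi_g
    have h : (S.map colim).Exact := hS.exact.map_of_epi_of_preservesCokernel _ ‹_› inferInstance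
    have hw (i) : S.f.app i ≫ S.g.app i = 0 := congr_app S.zero i
    have : Epi (colim.map S.g) := inferInstance
    exact ⟨h, t.mono_of_isColimit_heart S.f S.g hw
      (fun i ↦ hS.map_of_exact ((evaluation I t.Heart).obj i)) (colimit.isColimit S.X₁)
      (colimit.isColimit S.X₂) (colimit.isColimit S.X₃) (colim.map S.f) (colim.map S.g)
      (ι_colimMap S.f) (ι_colimMap S.g) _ h⟩

end TorsionPair

/-! ### Closure of the torsion-free class and the AB5 condition. -/

namespace TorsionPair

variable {G : Type u} [Category.{v} G] [Abelian G] [HasDerivedCategory.{w} G] (t : TorsionPair G)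

open DerivedCategory

attribute [local instance] TStructure.abelianHeart

lemma heart_singleFunctor_obj {X : G} (hX : t.torsionFree X) :
    t.hrsTStructure.heart ((singleFunctor G (-1)).obj X) := by
  rw [heart_iff]
  refine ⟨fun i hi _ ↦ ?_, t.torsion_of_isZero ?_,
    t.torsionFree.prop_of_iso ((singleFunctorCompHomologyFunctorIso G (-1)).app X).symm hX⟩
  · rcases lt_or_gt_of_ne hi with h | h
    · exact isZero_of_isGE _ (-1) i h
    · exact isZero_of_isLE _ (-1) i h
  · exact isZero_of_isLE _ (-1) 0 (by lia)

/-- Any diagram of torsion-free objects is obtained from a diagram in the heart by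
applying the homology functor in degree `-1`. -/
lemma exists_diagram_heart {J : Type*} [Category* J] (F : J ⥤ G)
    (hF : ∀ j, t.torsionFree (F.obj j)) :
    ∃ M : J ⥤ t.Heart, Nonempty (M ⋙ t.heartHomology (-1) ≅ F) :=
  ⟨t.hrsTStructure.heart.lift (F ⋙ singleFunctor G (-1)) fun j ↦ t.heart_singleFunctor_obj (hF j),
    ⟨Functor.isoWhiskerLeft F (singleFunctorCompHomologyFunctorIso G (-1))⟩⟩

variable [IsGrothendieckAbelian.{v} G]

instance hasColimitsOfShape_heart (I : Type v) [PartialOrder I] : HasColimitsOfShape I t.Heart where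

section

variable (I : Type v) [PartialOrder I] [IsDirectedOrder I] [Nonempty I]

lemma preservesColimitsOfShape_heartHomology [t.torsionFree.IsClosedUnderColimitsOfShape I]
    (n : ℤ) : PreservesColimitsOfShape I (t.heartHomology n) where
  preservesColimit {M} := by
    by_cases h₁ : n = -1
    · subst h₁
      exact t.preservesColimit_heartHomology_neg_one M
        (t.torsionFree.prop_colimit _ fun _ ↦ t.torsionFree_heartHomology _)
    by_cases h₀ : n = 0
    · subst h₀; infer_instance
    exact t.preservesColimit_heartHomology_of_ne M n h₁ h₀

/-- Every direct system in `ℱ` is `H⁻¹` of the system in the heart obtained by placing it in degree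
`-1`. -/
lemma isClosedUnderColimitsOfShape_of_torsionFree_colimit
    (h : ∀ M : I ⥤ t.Heart, t.torsionFree (colimit (M ⋙ t.heartHomology (-1)))) :
    t.torsionFree.IsClosedUnderColimitsOfShape I :=
  .mk' (by
    rintro _ ⟨F, hF⟩
    obtain ⟨M, ⟨e⟩⟩ := t.exists_diagram_heart F hF
    exact t.torsionFree.prop_of_iso (HasColimit.isoOfNatIso e) (h M))

lemma isClosedUnderColimitsOfShape_torsionFree
    [PreservesColimitsOfShape I (t.heartHomology (-1))] :
    t.torsionFree.IsClosedUnderColimitsOfShape I :=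
  t.isClosedUnderColimitsOfShape_of_torsionFree_colimit I fun M ↦
    t.torsionFree.prop_of_iso (preservesColimitIso (t.heartHomology (-1)) M)
      (t.torsionFree_heartHomology _)

end

lemma isAB5Abelian_heart (h : ∀ (I : Type v) [PartialOrder I] [IsDirectedOrder I] [Nonempty I],
    t.torsionFree.IsClosedUnderColimitsOfShape I) : IsAB5Abelian.{v} t.Heart := by
  have h₁ : HasFilteredColimitsOfSize.{v, v} t.Heart := ⟨fun J _ _ ↦ by
    -- Every small filtered category receives a final functor from a directed poset, so directed
    -- systems suffice.
    obtain ⟨I, _, _, _, F, _⟩ := IsFiltered.exists_directed J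
    exact Functor.Final.hasColimitsOfShape_of_final F⟩
  refine ⟨⟨inferInstance⟩, hasCoproducts_of_finite_and_filtered, h₁, ⟨fun J _ _ ↦ ?_⟩⟩
  obtain ⟨I, _, _, _, F, _⟩ := IsFiltered.exists_directed J
  have := t.preservesColimitsOfShape_heartHomology I (-1)
  have := t.hasExactColimitsOfShape_heart (I := I)
  exact hasExactColimitsOfShape_of_final t.Heart F

section

variable (I : Type v) [PartialOrder I] [IsDirectedOrder I] [Nonempty I]

/-- In elementwise terms: a section of `H⁻¹(M_i)` that dies in `H⁻¹(lim M)` already dies in `lim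
H⁻¹(M_j)`. It is lifted to `H⁻¹` of the limit of the kernels of `M_i ⟶ M_j`, on each of which the
map to `lim H⁻¹(M_j)` vanishes. -/
lemma comp_colimit_ι_eq_zero_of_isAB5Abelian (h : IsAB5Abelian.{v} t.Heart) (M : I ⥤ t.Heart)
    (i : I) {A : G} (x : A ⟶ (t.heartHomology (-1)).obj (M.obj i))
    (hx : x ≫ (t.heartHomology (-1)).map (colimit.ι M i) = 0) :
    x ≫ colimit.ι (M ⋙ t.heartHomology (-1)) i = 0 := by
  obtain ⟨-, -, _, _⟩ := h
  have : IsDirectedOrder (Set.Ici i) := ⟨fun a b ↦ by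
    obtain ⟨c, ha, hb⟩ := exists_ge_ge a.1 b.1
    exact ⟨⟨c, a.2.trans ha⟩, ha, hb⟩⟩
  have : Nonempty (Set.Ici i) := ⟨⟨i, le_rfl⟩⟩
  have : IsConnected (Set.Ici i) := IsFiltered.isConnected _
  have hmono : Monotone (fun j : Set.Ici i ↦ (j : I)) := fun _ _ h ↦ h
  let ρ : Set.Ici i ⥤ I := hmono.functor
  -- Restricting to the indices above `i`, where the kernels of `M_i ⟶ M_j` make sense, does not
  -- change the limit.
  have : ρ.Final := hmono.final_functor_iff.2 fun j ↦ by
    obtain ⟨k, hi, hj⟩ := exists_ge_ge i j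
    exact ⟨⟨k, hi⟩, hj⟩
  let α : (Functor.const (Set.Ici i)).obj (M.obj i) ⟶ ρ ⋙ M :=
    { app j := M.map (homOfLE j.2)
      naturality j k f := by
        refine (Category.id_comp _).trans ?_
        exact (congr_arg M.map (Subsingleton.elim _ _)).trans (M.map_comp _ _) }
  let K := kernel α
  have hm (j) : Mono ((kernel.ι α).app j) := inferInstance
  have hα (j) : (kernel.ι α).app j ≫ α.app j = 0 := congr_app (kernel.condition α) j
  have hex (j) : (ShortComplex.mk _ _ (hα j)).Exact :=
    (ShortComplex.exact_kernel α).map ((evaluation (Set.Ici i) t.Heart).obj j)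
  have hc : IsColimit ((colimit.cocone M).whisker ρ) :=
    (Functor.Final.isColimitWhiskerEquiv ρ _).symm (colimit.isColimit M)
  have hc₀ := isColimitConstCocone (Set.Ici i) (M.obj i)
  obtain ⟨f, hf⟩ : ∃ f : colimit K ⟶ M.obj i, ∀ j, colimit.ι K j ≫ f = (kernel.ι α).app j :=
    ⟨colimit.desc K (Cocone.mk (M.obj i) (kernel.ι α)), colimit.ι_desc _⟩
  have hf' (j) : colimit.ι K j ≫ f = (kernel.ι α).app j ≫ 𝟙 (M.obj i) := by
    rw [hf]; exact (Category.comp_id _).symm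
  have hg (j : Set.Ici i) : 𝟙 (M.obj i) ≫ colimit.ι M i =
      α.app j ≫ colimit.ι M (ρ.obj j) :=
    (Category.id_comp _).trans (colimit.w M (homOfLE j.2)).symm
  have w : f ≫ colimit.ι M i = 0 := by
    refine colimit.hom_ext fun j ↦ ?_
    rw [← Category.assoc, hf, comp_zero, colimit.w M (homOfLE j.2) |>.symm, ← Category.assoc]
    exact (congr_arg (· ≫ _) (hα j)).trans zero_comp
  -- AB5 in the heart enters here: `f` identifies the limit of the kernels with the kernel of `M_i ⟶
  -- lim M`.
  have ex : (ShortComplex.mk _ _ w).Exact :=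
    exact_of_isColimit (kernel.ι α) α hα hex (colimit.isColimit K) hc₀ hc f _ hf' hg w
  have hfm : Mono f := mono_of_isColimit (kernel.ι α) hm (colimit.isColimit K) hc₀ f hf'
  have exH := ex.map_of_mono_of_preservesKernel (t.heartHomology (-1)) hfm inferInstance
  have hHfm : Mono ((ShortComplex.mk _ _ w).map (t.heartHomology (-1))).f :=
    inferInstanceAs (Mono ((t.heartHomology (-1)).map f))
  obtain ⟨l, hl⟩ : ∃ l : A ⟶ (t.heartHomology (-1)).obj (colimit K),
      l ≫ (t.heartHomology (-1)).map f = x := ⟨exH.lift x hx, exH.lift_f x hx⟩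
  -- By AB5 in `G`, this limit is a subobject of the torsion-free object `H⁻¹(M_i)`, so `H⁻¹`
  -- preserves the limit of the system `K`.
  have hK : t.torsionFree (colimit (K ⋙ t.heartHomology (-1))) := by
    obtain ⟨y, hy⟩ : ∃ y : colimit (K ⋙ t.heartHomology (-1)) ⟶
        (t.heartHomology (-1)).obj (M.obj i), ∀ j, colimit.ι _ j ≫ y =
          (t.heartHomology (-1)).map ((kernel.ι α).app j) :=
      ⟨colimit.desc _ ((t.heartHomology (-1)).mapCocone (Cocone.mk (M.obj i) (kernel.ι α))),
        colimit.ι_desc _⟩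
    let γ : K ⋙ t.heartHomology (-1) ⟶
      (Functor.const (Set.Ici i)).obj ((t.heartHomology (-1)).obj (M.obj i)) :=
        { app j := (t.heartHomology (-1)).map ((kernel.ι α).app j)
          naturality j k f := (Functor.map_comp _ _ _).symm.trans
            ((congr_arg (t.heartHomology (-1)).map ((kernel.ι α).naturality f)).trans
              ((t.heartHomology (-1)).map_comp _ _) |>.trans
                (congr_arg (_ ≫ ·) ((t.heartHomology (-1)).map_id _))) }
    have : Mono y := mono_of_isColimit γ
      (fun j ↦ inferInstanceAs (Mono ((t.heartHomology (-1)).map ((kernel.ι α).app j))))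
      (colimit.isColimit _) (isColimitConstCocone (Set.Ici i) _) y
      fun j ↦ (hy j).trans (Category.comp_id _).symm
    exact t.torsionFree_of_mono y (t.torsionFree_heartHomology _)
  have := t.preservesColimit_heartHomology_neg_one K hK
  have h0 : (t.heartHomology (-1)).map f ≫ colimit.ι (M ⋙ t.heartHomology (-1)) i = 0 := by
    refine (isColimitOfPreserves (t.heartHomology (-1)) (colimit.isColimit K)).hom_ext fun j ↦ ?_
    have : (t.heartHomology (-1)).map (colimit.ι K j) ≫ (t.heartHomology (-1)).map f ≫
        colimit.ι (M ⋙ t.heartHomology (-1)) i = 0 := by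
      rw [← Category.assoc, ← Functor.map_comp, hf,
        ← colimit.w (M ⋙ t.heartHomology (-1)) (homOfLE j.2), ← Category.assoc]
      refine (congr_arg (· ≫ _) ?_).trans zero_comp
      exact ((t.heartHomology (-1)).map_comp _ _).symm.trans
        ((congr_arg (t.heartHomology (-1)).map (hα j)).trans (Functor.map_zero _ _ _))
    exact this.trans comp_zero.symm
  rw [← hl, Category.assoc, h0, comp_zero]

/-- The limit of the `H⁻¹(M_i)` embeds in the torsion-free object `H⁻¹(lim M)`: the kernel of the
comparison is the limit of its restrictions to the stages `i`, and each of these maps to zero. -/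
lemma torsionFree_colimit_of_isAB5Abelian (h : IsAB5Abelian.{v} t.Heart) (M : I ⥤ t.Heart) :
    t.torsionFree (colimit (M ⋙ t.heartHomology (-1))) := by
  have : IsConnected I := IsFiltered.isConnected I
  let u := colimit.post M (t.heartHomology (-1))
  suffices Mono u from t.torsionFree_of_mono u (t.torsionFree_heartHomology _)
  obtain ⟨hK⟩ := (colimit.cocone (M ⋙ t.heartHomology (-1))).nonempty_isColimit_kernelCocone u
    (colimit.isColimit _)
  refine Preadditive.mono_of_kernel_zero (hK.hom_ext fun i ↦ ?_)
  refine (kernel.lift_ι _ _ _).trans (Eq.trans ?_ comp_zero.symm)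
  refine t.comp_colimit_ι_eq_zero_of_isAB5Abelian I h M i _ ?_
  refine Eq.trans ?_ (kernel.condition (colimit.ι (M ⋙ t.heartHomology (-1)) i ≫ u))
  exact congr_arg (_ ≫ ·) (colimit.ι_post M (t.heartHomology (-1)) i).symm

end

end TorsionPair

/-! ### The equivalence of the four assertions. -/

theorem mainTheorem3 {G : Type u} [Category.{v} G] [Abelian G] [IsGrothendieckAbelian.{v} G]
    [HasDerivedCategory.{w} G] (t : TorsionPair G) :
    List.TFAE [
      -- 1) the heart is an AB5 abelian category
      IsAB5Abelian.{v} t.Heart,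
      -- 2) `ℱ` is closed under direct limits, and for each direct system `M` in the heart and each
      -- triangle `∐_{i ≤ j} M_{ij} ⟶ ∐_i M_i ⟶ Z ⟶` in `D(G)` on the colimit-defining morphism,
      -- `lim H⁻¹(M_i) ⟶ H⁻¹(Z) ⟶ H⁻¹(Z) / t(H⁻¹(Z))` is a monomorphism
      (∀ (I : Type v) [PartialOrder I] [IsDirectedOrder I] [Nonempty I],
        t.torsionFree.IsClosedUnderColimitsOfShape I) ∧
      (∀ (I : Type v) [PartialOrder I] [IsDirectedOrder I] [Nonempty I] (M : I ⥤ t.Heart)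
        (c₂ : Cofan fun p : {p : I × I // p.1 ≤ p.2} ↦ (M ⋙ t.heartι).obj p.1.1)
        (hc₂ : IsColimit c₂) (c₁ : Cofan (M ⋙ t.heartι).obj) (_ : IsColimit c₁)
        (Z : DerivedCategory G) (q : c₁.pt ⟶ Z) (r : Z ⟶ c₂.pt⟦(1 : ℤ)⟧)
        (hT : Triangle.mk (colimitDefiningMorphism (M ⋙ t.heartι) hc₂ c₁) q r ∈
          distTriang (DerivedCategory G)),
        Mono (colimit.desc ((M ⋙ t.heartι) ⋙ DerivedCategory.homologyFunctor G (-1))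
            ((DerivedCategory.homologyFunctor G (-1)).mapCocone
              (colimitDefiningCocone (M ⋙ t.heartι) hc₂ c₁ q
                (comp_distTriang_mor_zero₁₂ _ hT))) ≫
          t.π ((DerivedCategory.homologyFunctor G (-1)).obj Z))),
      -- 3) `ℱ` is closed under direct limits, and for each direct system `M` in the heart, with
      -- direct limit `c` in the heart, `lim H⁻¹(M_i) ⟶ H⁻¹(c)` is a monomorphism
      (∀ (I : Type v) [PartialOrder I] [IsDirectedOrder I] [Nonempty I],
        t.torsionFree.IsClosedUnderColimitsOfShape I) ∧
      (∀ (I : Type v) [PartialOrder I] [IsDirectedOrder I] [Nonempty I] (M : I ⥤ t.Heart)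
        (c : Cocone M) (_ : IsColimit c),
        Mono (colimit.desc (M ⋙ t.heartHomology (-1)) ((t.heartHomology (-1)).mapCocone c))),
      -- 4) the functors `H^m`, restricted to the heart, preserve direct limits
      ∀ (m : ℤ) (I : Type v) [PartialOrder I] [IsDirectedOrder I] [Nonempty I],
        PreservesColimitsOfShape I (t.heartHomology m)] := by
  tfae_have 1 → 2 := fun h ↦ by
    have h₀ (I : Type v) [PartialOrder I] [IsDirectedOrder I] [Nonempty I] :
        t.torsionFree.IsClosedUnderColimitsOfShape I :=
      t.isClosedUnderColimitsOfShape_of_torsionFree_colimit I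
        fun M ↦ t.torsionFree_colimit_of_isAB5Abelian I h M
    refine ⟨fun I ↦ h₀ I, fun I _ _ _ M c₂ hc₂ c₁ hc₁ Z q r hT ↦ ?_⟩
    have := t.isIso_desc_comp_π M hc₂ hc₁ q r hT
      (t.torsionFree.prop_colimit _ fun _ ↦ t.torsionFree_heartHomology _)
    exact IsIso.mono_of_iso _
  tfae_have 2 → 3 := fun ⟨h₀, _⟩ ↦ by
    refine ⟨fun I ↦ h₀ I, fun I _ _ _ M c hc ↦ ?_⟩
    have := t.preservesColimitsOfShape_heartHomology I (-1)
    have h := isColimitOfPreserves (t.heartHomology (-1)) hc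
    -- The canonical morphism is the comparison between two colimits of the same diagram, hence an
    -- isomorphism.
    exact inferInstanceAs (Mono ((colimit.isColimit _).coconePointUniqueUpToIso h).hom)
  tfae_have 3 → 4 := fun ⟨h₀, _⟩ m I _ _ _ ↦ t.preservesColimitsOfShape_heartHomology I m
  tfae_have 4 → 1 := fun h ↦ t.isAB5Abelian_heart fun I _ _ _ ↦
    have := h (-1) I
    t.isClosedUnderColimitsOfShape_torsionFree I
  tfae_finish
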